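/- Let $\mathcal R'$ be a Riemann surface without boundary and let $\mathcal M\subseteq\mathcal R'$ be a closed subset, regarded as a Riemann surface with boundary: $\partial\mathcal M\neq\emptyset$ is a closed subset of $\mathcal M$ that consists of the topological frontier of $\mathcal M$ in $\mathcal R'$ and possibly of further points that are isolated in $\partial\mathcal M$, and $\mathrm{Int}(\mathcal M)=\mathcal M\setminus\partial\mathcal M$. Let $Y=(Y_1,Y_2,Y_3):\mathcal M\to\mathbb R^3$ be the restriction of a smooth map $\mathcal R'\to\mathbb R^3$ such that $Y$ is a conformal immersion with zero mean curvature on $\mathrm{Int}(\mathcal M)$ (a conformal minimal immersion, possibly singular at boundary points), and suppose that $Y:\mathcal M\to\mathbb R^3$ is proper. Let $\pi_0:\mathbb R^3\to\{x_3=0\}\equiv\mathbb C$ be the orthogonal projection. Suppose that $Y$ is injective on $\mathcal M$ and that $Y(\mathcal M)$ is a graph over a closed set $\Omega\subseteq\mathbb C$, that is, $Y(\mathcal M)=\{(z,u(z)) : z\in\Omega\}$ for a continuous function $u:\Omega\to\mathbb R$, and that $\Omega$ is starlike with respect to $\pi_0(Y(p_0))$ for some $p_0\in\mathrm{Int}(\mathcal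 M)$, that is, $\Omega$ contains the segment from $\pi_0(Y(p_0))$ to each of its points. Then $\mathcal M$ is relative parabolic: if $f:\mathcal M\to\mathbb R$ is bounded and continuous on $\mathcal M$, harmonic in $\mathrm{Int}(\mathcal M)$, and zero on $\partial\mathcal M$, then $f=0$ on $\mathcal M$. -/

import Mathlib

open scoped Manifold ContDiff Topology

noncomputable section

namespace MinimalGraph

/-- Euclidean three-space. -/
abbrev E3 : Type := EuclideanSpace ℝ (Fin 3)

/-- The orthogonal projection onto the plane `{x₃ = 0}`, identified with `ℂ`. -/
def proj (x : E3) : ℂ := ⟨x 0, x 1⟩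

/-- The partial derivative `∂F/∂u`, where `z = u + i v`. -/
def du (F : ℂ → E3) (z : ℂ) : E3 := fderiv ℝ F z 1

/-- The partial derivative `∂F/∂v`, where `z = u + i v`. -/
def dv (F : ℂ → E3) (z : ℂ) : E3 := fderiv ℝ F z Complex.I

/-- The cross product in Euclidean three-space. -/
def cross (a b : E3) : E3 := WithLp.toLp 2 (crossProduct (WithLp.ofLp a) (WithLp.ofLp b))

/-- The unit normal of a parametrized surface `F`. -/
def unitNormal (F : ℂ → E3) (z : ℂ) : E3 :=
  ‖cross (du F z) (dv F z)‖⁻¹ • cross (du F z) (dv F z)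

/-- The mean curvature `(eG - 2fF + gE) / (2(EG - F²))` of a parametrized surface in terms of
its first and second fundamental forms. -/
def meanCurvature (F : ℂ → E3) (z : ℂ) : ℝ :=
  (inner ℝ (du (du F) z) (unitNormal F z) * inner ℝ (dv F z) (dv F z)
      - 2 * inner ℝ (du (dv F) z) (unitNormal F z) * inner ℝ (du F z) (dv F z)
      + inner ℝ (dv (dv F) z) (unitNormal F z) * inner ℝ (du F z) (du F z)) /
    (2 * (inner ℝ (du F z) (du F z) * inner ℝ (dv F z) (dv F z)
      - inner ℝ (du F z) (dv F z) ^ 2))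

section Surface

variable {R : Type*} [TopologicalSpace R] [ChartedSpace ℂ R]

/-- `M` is a closed subset of the surface `R`, regarded as a surface with boundary `B`: the
boundary consists of the topological frontier of `M` and possibly of further isolated points.
The interior of the surface with boundary is `M \ B`, which is open in `R`. -/
structure IsSurfaceWithBoundary (M B : Set R) : Prop where
  isClosed : IsClosed M
  isClosed_boundary : IsClosed B
  boundary_subset : B ⊆ M
  frontier_subset : frontier M ⊆ B
  isolated : ∀ p ∈ B \ frontier M, ∃ U ∈ 𝓝 p, U ∩ B = {p}

/-- A real function on a Riemann surface is harmonic at `p`: in every holomorphic chart of the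
atlas around `p` it is harmonic near the image of `p`. -/
def IsHarmonicAt (f : R → ℝ) (p : R) : Prop :=
  ∀ e ∈ atlas ℂ R, p ∈ e.source → InnerProductSpace.HarmonicAt (f ∘ e.symm) (e p)

/-- The surface `M` with boundary `B` is relative parabolic: a bounded continuous function on `M`
that is harmonic in the interior and vanishes on the boundary is zero. -/
def IsRelativeParabolic (M B : Set R) : Prop :=
  ∀ f : R → ℝ, ContinuousOn f M → (∃ C : ℝ, ∀ p ∈ M, |f p| ≤ C) →
    (∀ p ∈ M \ B, IsHarmonicAt f p) → (∀ p ∈ B, f p = 0) → ∀ p ∈ M, f p = 0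

/-- `Y` is a conformal minimal immersion of the surface `M` with boundary `B`: it is smooth (as a
map on the ambient surface), and in the interior of `M` it is a conformal immersion with zero mean
curvature. It may be singular at boundary points. -/
structure IsConformalMinimalImmersion (Y : R → E3) (M B : Set R) : Prop where
  smooth : ContMDiff 𝓘(ℝ, ℂ) 𝓘(ℝ, E3) ∞ Y
  conformal : ∀ p ∈ M \ B, ∀ e ∈ atlas ℂ R, p ∈ e.source → ConformalAt (Y ∘ e.symm) (e p)
  minimal : ∀ p ∈ M \ B, ∀ e ∈ atlas ℂ R, p ∈ e.source → meanCurvature (Y ∘ e.symm) (e p) = 0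

/-- `Y` maps `M` injectively onto the graph of a continuous function over `Ω`. -/
def IsGraphOver (Y : R → E3) (M : Set R) (Ω : Set ℂ) : Prop :=
  Set.InjOn Y M ∧ ∃ u : ℂ → ℝ, ContinuousOn u Ω ∧
    Y '' M = {x : E3 | proj x ∈ Ω ∧ x 2 = u (proj x)}

end Surface

end MinimalGraph

end

/-! Applying the argument to `f` and `-f`, it suffices to show `f ≤ 0`. Two barriers make up for the
lack of compactness.

Slab barrier. Let `t` be the second coordinate and `r` the distance to a line parallel to the
`t`-axis. The coordinates of a minimal surface are harmonic, so `Δ log r ≤ |∇t|² / r²` while `Δ t² =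
2 |∇t|²`. Hence `log r - t²` is strictly superharmonic where `r ≥ 1` and `∇t ≠ 0`, and it tends to
infinity at the ends of a slab of bounded `t`. Since the surface is a graph over a closed set, every
slab admits a line at distance at least 1 from it. The outcome is `IsGraphLift.halfSpace_le`:
suitable functions bounded above are controlled by their values on the boundary and on a single
slice `t = t₀`.

The slice through `z₀`. If a nonzero linear form in the first two coordinates had a critical point,
at least three level arms would meet there. A complementary form would map these arms injectively
into the line, which is impossible. So the projection is a local diffeomorphism in the interior.
Starlikeness makes the interior part of the slice an interval `J` and gives `t` a global harmonic
conjugate `Q`. The function `Φ = Q + i(t - t₀)` is holomorphic, is real exactly on the slice, and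
`Q` is strictly monotone along `J` with open image `I`. Take the Green functions of the plane slit
along `[-r, r] ⊆ I`, with poles at the two ends of `I` (possibly at infinity), and pull them back by
`Φ`. Their sum `V ≥ 0` is harmonic off the preimage of the slit and blows up at both ends of the
slice.

Conclusion (`IsGraphLift.exists_forall_le_max`, `IsGraphLift.harmonic_nonpos`). Let `s ≥ 0` bound
`f` on the preimage of the slit, with `s` either 0 or a value of `f`. If `f - s - ε V` were positive
on the slice, its maximum there would be attained and would be global by the half-space principle.
The strong maximum principle would then spread it along `J` to the slit, where the function is
nonpositive. Letting `ε → 0` gives `f ≤ s`, so a positive supremum of `f` would be attained.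
Connectedness of `Ω` would carry that value to the nonempty boundary, where `f = 0`. -/

section

open scoped Laplacian
open Set Filter InnerProductSpace

namespace MinimalGraph

/-! ### Maximum principles in the plane -/

/-- A real function that is twice continuously differentiable has nonpositive second derivative at
a local maximum. -/
theorem deriv_deriv_nonpos_of_isLocalMax {f : ℝ → ℝ} {x : ℝ} (hf : ContinuousAt f x)
    (h : IsLocalMax f x) : deriv (deriv f) x ≤ 0 := by
  by_contra! hc
  have hmin := isLocalMin_of_deriv_deriv_pos hc h.deriv_eq_zero hf
  have hconst : f =ᶠ[𝓝 x] fun _ => f x := by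
    filter_upwards [h, hmin] with y h1 h2 using le_antisymm h1 h2
  have h1 : deriv f =ᶠ[𝓝 x] fun _ => 0 := by
    have := hconst.deriv
    simpa using this
  have h2 := h1.deriv_eq
  simp at h2
  linarith

theorem hasDerivAt_line (x v : ℂ) (s : ℝ) : HasDerivAt (fun s : ℝ => x + s • v) v s := by
  have := ((hasDerivAt_id s).smul_const v).const_add x
  rwa [one_smul] at this

theorem tendsto_line (x v : ℂ) : Tendsto (fun s : ℝ => x + s • v) (𝓝 0) (𝓝 x) := by
  have := (hasDerivAt_line x v 0).continuousAt.tendsto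
  rwa [zero_smul, add_zero] at this

theorem iteratedFDeriv_two_apply_self {f : ℂ → ℝ} {x : ℂ} (hf : ContDiffAt ℝ 2 f x) (v : ℂ) :
    iteratedFDeriv ℝ 2 f x ![v, v] = deriv (deriv fun s : ℝ => f (x + s • v)) 0 := by
  have hd : ∀ᶠ y in 𝓝 x, DifferentiableAt ℝ f y :=
    (hf.eventually (by simp)).mono fun y hy => hy.differentiableAt (by norm_num)
  have h1 : (deriv fun s : ℝ => f (x + s • v)) =ᶠ[𝓝 0] fun s => fderiv ℝ f (x + s • v) v := by
    filter_upwards [(tendsto_line x v).eventually hd] with s hs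
    exact (hs.hasFDerivAt.comp_hasDerivAt s (hasDerivAt_line x v s)).deriv
  have h2 : DifferentiableAt ℝ (fderiv ℝ f) x :=
      (hf.fderiv_right (m := 1) (by norm_num)).differentiableAt (by norm_num)
  have h3 : HasFDerivAt (fun y => fderiv ℝ f y v)
      ((ContinuousLinearMap.apply ℝ ℝ v).comp (fderiv ℝ (fderiv ℝ f) x)) x :=
    (ContinuousLinearMap.apply ℝ ℝ v).hasFDerivAt.comp x h2.hasFDerivAt
  have h4 : HasFDerivAt (fun y => fderiv ℝ f y v)
      ((ContinuousLinearMap.apply ℝ ℝ v).comp (fderiv ℝ (fderiv ℝ f) x)) (x + (0 : ℝ) • v) := by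
    rwa [zero_smul, add_zero]
  rw [h1.deriv_eq, iteratedFDeriv_two_apply]
  exact (h4.comp_hasDerivAt (0 : ℝ) (hasDerivAt_line x v 0)).deriv.symm

/-- The Laplacian is nonpositive at a local maximum. -/
theorem laplacian_nonpos_of_isLocalMax {f : ℂ → ℝ} {x : ℂ} (hf : ContDiffAt ℝ 2 f x)
    (h : IsLocalMax f x) : Δ f x ≤ 0 := by
  have key : ∀ v : ℂ, iteratedFDeriv ℝ 2 f x ![v, v] ≤ 0 := fun v => by
    rw [iteratedFDeriv_two_apply_self hf]
    apply deriv_deriv_nonpos_of_isLocalMax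
    · have := hf.continuousAt.tendsto.comp (tendsto_line x v)
      simpa [ContinuousAt, Function.comp_def] using this
    · have := (tendsto_line x v).eventually h
      simpa [IsLocalMax, IsMaxFilter] using this
  rw [laplacian_eq_iteratedFDeriv_complexPlane]
  exact add_nonpos (key 1) (key Complex.I)

/-- A harmonic function is locally the real part of an analytic function. -/
theorem exists_analyticAt_re_eq {f : ℂ → ℝ} {x : ℂ} (hf : HarmonicAt f x) :
    ∃ F : ℂ → ℂ, AnalyticAt ℂ F x ∧ (fun ζ => (F ζ).re) =ᶠ[𝓝 x] f := by
  obtain ⟨r, hr, h⟩ := Metric.eventually_nhds_iff_ball.1 hf.eventually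
  obtain ⟨F, hF, he⟩ := HarmonicOnNhd.exists_analyticOnNhd_ball_re_eq (f := f) (z := x) (R := r) h
  exact ⟨F, hF x (Metric.mem_ball_self hr), Filter.eventuallyEq_of_mem (Metric.ball_mem_nhds x hr) he⟩

/-- The strong maximum principle: a harmonic function is constant near a local maximum. -/
theorem eventually_eq_of_harmonicAt_of_isLocalMax {f : ℂ → ℝ} {x : ℂ} (hf : HarmonicAt f x)
    (h : IsLocalMax f x) : ∀ᶠ y in 𝓝 x, f y = f x := by
  obtain ⟨F, hF, he⟩ := exists_analyticAt_re_eq hf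
  have hd : ∀ᶠ y in 𝓝 x, DifferentiableAt ℂ (fun ζ => Complex.exp (F ζ)) y :=
    hF.eventually_analyticAt.mono fun y hy => hy.differentiableAt.cexp
  -- Since `|exp F| = exp (Re F)`, the maximum modulus principle applies to `exp F`.
  have hm : IsLocalMax (norm ∘ fun ζ => Complex.exp (F ζ)) x := by
    filter_upwards [h, he] with y hy hey
    have hex := he.self_of_nhds
    simp only [Function.comp, Complex.norm_exp]
    simp only at hex hey
    rw [hey, hex]
    exact Real.exp_le_exp.2 hy
  filter_upwards [Complex.eventually_eq_of_isLocalMax_norm hd hm, he] with y hy hey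
  have hex := he.self_of_nhds
  have := congrArg norm hy
  simp only [Complex.norm_exp, Real.exp_eq_exp] at this
  simp only at hex hey
  rw [← hey, ← hex, this]

/-! ### Critical points of harmonic functions and injectivity -/

/-- A tripod does not embed into the real line. -/
theorem not_tripod_injective {β : Fin 3 → ℝ → ℝ} {δ y : ℝ} (hδ : 0 < δ)
    (hc : ∀ i, ContinuousOn (β i) (Icc 0 δ)) (h0 : ∀ i, β i 0 = y)
    (hinj : ∀ i j, ∀ s ∈ Icc 0 δ, ∀ s' ∈ Icc 0 δ, β i s = β j s' → s = s' ∧ (i = j ∨ s = 0)) :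
    False := by
  have hδm : δ ∈ Icc 0 δ := ⟨hδ.le, le_rfl⟩
  have h0m : (0 : ℝ) ∈ Icc 0 δ := ⟨le_rfl, hδ.le⟩
  have hne : ∀ i, β i δ ≠ y := fun i h => by
    have := (hinj i i δ hδm 0 h0m (by rw [h, h0])).1
    linarith
  -- Of two arms ending on the same side of `y`, the longer one passes through the endpoint of the
  -- shorter. Three arms have only two sides to choose from.
  have up : ∀ i j, i ≠ j → y < β i δ → β i δ ≤ β j δ → False := fun i j hij h1 h2 => by
    obtain ⟨s, hs, hs'⟩ := intermediate_value_Icc hδ.le (hc j) (show β i δ ∈ Icc (β j 0) (β j δ) from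
      ⟨by rw [h0]; exact h1.le, h2⟩)
    rcases (hinj i j δ hδm s hs hs'.symm).2 with h | h
    · exact hij h
    · linarith
  have dn : ∀ i j, i ≠ j → β i δ < y → β j δ ≤ β i δ → False := fun i j hij h1 h2 => by
    obtain ⟨s, hs, hs'⟩ := intermediate_value_Icc' hδ.le (hc j) (show β i δ ∈ Icc (β j δ) (β j 0) from
      ⟨h2, by rw [h0]; exact h1.le⟩)
    rcases (hinj i j δ hδm s hs hs'.symm).2 with h | h
    · exact hij h
    · linarith
  have pos : ∀ i j, i ≠ j → y < β i δ → y < β j δ → False := fun i j hij h1 h2 =>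
    (le_total (β i δ) (β j δ)).elim (up i j hij h1) (up j i hij.symm h2)
  have neg : ∀ i j, i ≠ j → β i δ < y → β j δ < y → False := fun i j hij h1 h2 =>
    (le_total (β j δ) (β i δ)).elim (dn i j hij h1) (dn j i hij.symm h2)
  rcases lt_or_gt_of_ne (hne 0) with h | h <;> rcases lt_or_gt_of_ne (hne 1) with h' | h' <;>
    rcases lt_or_gt_of_ne (hne 2) with h'' | h''
  · exact neg 0 1 (by decide) h h'
  · exact neg 0 1 (by decide) h h'
  · exact neg 0 2 (by decide) h h''
  · exact pos 1 2 (by decide) h' h''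
  · exact neg 1 2 (by decide) h' h''
  · exact pos 0 2 (by decide) h h''
  · exact pos 0 1 (by decide) h h'
  · exact pos 0 1 (by decide) h h'

/-- Near a zero of order `n`, an analytic function is the `n`-th power of a local coordinate. -/
theorem exists_eq_pow_openPartialHomeomorph {g : ℂ → ℂ} {x : ℂ} {n : ℕ} (hn : n ≠ 0)
    (hg : AnalyticAt ℂ g x) (hgx : g x ≠ 0) :
    ∃ e : OpenPartialHomeomorph ℂ ℂ, x ∈ e.source ∧ e x = 0 ∧
      ∀ᶠ ζ in 𝓝 x, (ζ - x) ^ n * g ζ = e ζ ^ n := by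
  have hn' : (n : ℂ) ≠ 0 := Nat.cast_ne_zero.2 hn
  -- An `n`-th root of `g`: normalizing by `g x` keeps the argument of the power near 1, away from
  -- the branch cut.
  set k : ℂ → ℂ := fun ζ => (g x) ^ ((n : ℂ)⁻¹) * (g ζ / g x) ^ ((n : ℂ)⁻¹) with hk
  have hslit : g x / g x ∈ Complex.slitPlane := by rw [div_self hgx]; exact Complex.one_mem_slitPlane
  have hka : AnalyticAt ℂ k x :=
    analyticAt_const.mul ((hg.div analyticAt_const hgx).cpow analyticAt_const hslit)
  have hkx : k x ≠ 0 := by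
    simp only [hk, div_self hgx, Complex.one_cpow, mul_one]
    simp [Complex.cpow_eq_zero_iff, hgx]
  have hψ : AnalyticAt ℂ (fun ζ => (ζ - x) * k ζ) x :=
    (analyticAt_id.sub analyticAt_const).mul hka
  have hd : HasDerivAt (fun ζ => (ζ - x) * k ζ) (k x) x := by
    have := ((hasDerivAt_id x).sub_const x).fun_mul hka.differentiableAt.hasDerivAt
    simpa using this
  have hsd : HasStrictDerivAt (fun ζ => (ζ - x) * k ζ) (k x) x := by
    have := hψ.hasStrictDerivAt
    rwa [hd.deriv] at this
  have hsf := hsd.hasStrictFDerivAt_equiv hkx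
  refine ⟨hsf.toOpenPartialHomeomorph _, hsf.mem_toOpenPartialHomeomorph_source, by simp, ?_⟩
  refine Eventually.of_forall fun ζ => ?_
  simp only [HasStrictFDerivAt.toOpenPartialHomeomorph_coe, mul_pow, hk]
  rw [Complex.cpow_nat_inv_pow _ hn, Complex.cpow_nat_inv_pow _ hn, mul_div_cancel₀ _ hgx]

/-- An injective pair of real functions on a plane domain, the first of them harmonic: the
differential of the harmonic function has no zeros. -/
theorem fderiv_ne_zero_of_injOn {a b : ℂ → ℝ} {x : ℂ} (ha : HarmonicAt a x) {U : Set ℂ}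
    (hU : U ∈ 𝓝 x) (hb : ContinuousOn b U) (hinj : InjOn (fun ζ => (a ζ, b ζ)) U) :
    fderiv ℝ a x ≠ 0 := by
  intro hda
  obtain ⟨F, hF, he⟩ := exists_analyticAt_re_eq ha
  have hdF : deriv F x = 0 := by
    have h1 : HasFDerivAt (fun ζ => (F ζ).re) (Complex.reCLM.comp
        ((ContinuousLinearMap.toSpanSingleton ℂ (deriv F x)).restrictScalars ℝ)) x :=
      Complex.reCLM.hasFDerivAt.comp x
        (hF.differentiableAt.hasDerivAt.hasFDerivAt.restrictScalars ℝ)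
    have h2 := h1.fderiv
    rw [he.fderiv_eq, hda] at h2
    have h3 := DFunLike.congr_fun h2 1
    have h4 := DFunLike.congr_fun h2 Complex.I
    simp at h3 h4
    exact Complex.ext (by simpa using h3.symm) (by simpa using h4)
  -- three arms of the level set through `x`
  obtain ⟨e, hxe, hex, v, hv1, hvinj, harm⟩ : ∃ e : OpenPartialHomeomorph ℂ ℂ, x ∈ e.source ∧
      e x = 0 ∧ ∃ v : Fin 3 → ℂ, (∀ i, ‖v i‖ = 1) ∧ Function.Injective v ∧
      ∀ᶠ ζ in 𝓝 x, ∀ i, ∀ s : ℝ, e ζ = s • v i → a ζ = a x := by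
    have hG : AnalyticAt ℂ (fun ζ => F ζ - F x) x := hF.sub analyticAt_const
    have hex := he.self_of_nhds
    simp only at hex
    -- If `F` is constant near `x`, any three rays serve. Otherwise `F - F x` vanishes to order `n ≥
    -- 2`, because `F' x = 0`.
    rcases eq_or_ne (analyticOrderAt (fun ζ => F ζ - F x) x) ⊤ with htop | htop
    · refine ⟨(Homeomorph.subRight x).toOpenPartialHomeomorph, by simp, by simp,
        ![1, -1, Complex.I], ?_, ?_, ?_⟩
      · intro i; fin_cases i <;> simp
      · intro i j hij
        fin_cases i <;> fin_cases j <;> simp [Complex.ext_iff] at hij ⊢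
        all_goals norm_num at hij
      · filter_upwards [analyticOrderAt_eq_top.1 htop, he] with ζ h1 h2 i s _
        rw [← h2, ← hex, sub_eq_zero.1 h1]
    · obtain ⟨g, hg, hgx, hgeq⟩ := hG.analyticOrderAt_ne_top.1 htop
      set n := analyticOrderNatAt (fun ζ => F ζ - F x) x with hn
      have hn0 : n ≠ 0 := by
        intro h0
        have := hgeq.self_of_nhds
        rw [h0] at this
        simp at this
        exact hgx this.symm
      have hn1 : n ≠ 1 := by
        intro h1
        have hd : HasDerivAt (fun ζ => (ζ - x) ^ 1 • g ζ) (g x) x := by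
          have := ((hasDerivAt_id x).sub_const x).fun_mul hg.differentiableAt.hasDerivAt
          simpa using this
        rw [h1] at hgeq
        have h2 := (hd.congr_of_eventuallyEq hgeq).deriv
        rw [deriv_sub_const, hdF] at h2
        exact hgx h2.symm
      have hn2 : 2 ≤ n := by omega
      obtain ⟨e, hxe, hex0, hpow⟩ := exists_eq_pow_openPartialHomeomorph hn0 hg hgx
      have hnR : (0 : ℝ) < n := by positivity
      -- The zero directions of `Re wⁿ` are the angles `(π/2 + π i)/n`. For `i = 0, 1, 2` they lie
      -- in `[0, 2π)` as soon as `n ≥ 2`, hence are distinct.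
      refine ⟨e, hxe, hex0, fun i => Complex.exp (((Real.pi / 2 + Real.pi * i) / n : ℝ) * Complex.I),
        fun i => Complex.norm_exp_ofReal_mul_I _, ?_, ?_⟩
      · intro i j hij
        have hlt : ∀ i : Fin 3, ((Real.pi / 2 + Real.pi * i) / n : ℝ) ∈ Ico 0 (2 * Real.pi) := by
          intro i
          have hi : ((i : ℕ) : ℝ) ≤ 2 := by
            have := i.2
            exact_mod_cast Nat.lt_succ_iff.1 this
          have hpi := Real.pi_pos
          refine ⟨by positivity, ?_⟩
          rw [div_lt_iff₀ hnR]
          have : (2 : ℝ) ≤ n := by exact_mod_cast hn2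
          nlinarith
        have hexp := Complex.exp_eq_exp_iff_exists_int.1 hij
        obtain ⟨m, hm⟩ := hexp
        have him := congrArg Complex.im hm
        simp at him
        have h1 := hlt i
        have h2 := hlt j
        have hpi := Real.pi_pos
        have hm0 : m = 0 := by
          have e1 : (m : ℝ) * (2 * Real.pi) < 1 * (2 * Real.pi) := by linarith [h1.2, h2.1]
          have e2 : (-1 : ℝ) * (2 * Real.pi) < m * (2 * Real.pi) := by linarith [h1.1, h2.2]
          have e3 : (m : ℝ) < 1 := lt_of_mul_lt_mul_right e1 (by positivity)
          have e4 : (-1 : ℝ) < m := lt_of_mul_lt_mul_right e2 (by positivity)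
          have e5 : m < 1 := by exact_mod_cast e3
          have e6 : -1 < m := by exact_mod_cast e4
          omega
        rw [hm0] at him
        simp only [Int.cast_zero, zero_mul, add_zero] at him
        rw [div_left_inj' hnR.ne'] at him
        have : Real.pi * (i : ℕ) = Real.pi * (j : ℕ) := by linarith
        have := mul_left_cancel₀ hpi.ne' this
        exact Fin.ext (by exact_mod_cast this)
      · filter_upwards [hgeq, hpow, he] with ζ h1 h2 h3 i s hs
        have h4 : F ζ - F x = e ζ ^ n := by rw [h1, ← h2, smul_eq_mul]
        have h5 : (Complex.exp (((Real.pi / 2 + Real.pi * i) / n : ℝ) * Complex.I)) ^ n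
            = Complex.exp ((Real.pi / 2 + Real.pi * i : ℝ) * Complex.I) := by
          rw [← Complex.exp_nat_mul]
          congr 1
          push_cast
          field_simp
        have h6 : (e ζ ^ n).re = 0 := by
          rw [hs, smul_pow, h5, Complex.smul_re, Complex.exp_ofReal_mul_I_re,
            add_comm, Real.cos_add_pi_div_two]
          simp [mul_comm Real.pi, Real.sin_nat_mul_pi]
        have h7 := congrArg Complex.re h4
        rw [h6, Complex.sub_re, h3, hex] at h7
        linarith
  have hx0 : e.symm 0 = x := by rw [← hex, e.left_inv hxe]
  have h0t : (0 : ℂ) ∈ e.target := hex ▸ e.map_source hxe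
  have hcont : ContinuousAt e.symm 0 := e.continuousAt_symm h0t
  have hev : ∀ᶠ w in 𝓝 (0 : ℂ), w ∈ e.target ∧ e.symm w ∈ interior U ∧
      ∀ i, ∀ s : ℝ, e (e.symm w) = s • v i → a (e.symm w) = a x := by
    have h1 : Tendsto e.symm (𝓝 0) (𝓝 x) := by simpa [ContinuousAt, hx0] using hcont
    exact (e.open_target.eventually_mem h0t).and
      ((h1.eventually (isOpen_interior.eventually_mem (mem_interior_iff_mem_nhds.2 hU))).and
        (h1.eventually harm))
  obtain ⟨δ, hδ, hball⟩ := Metric.eventually_nhds_iff_ball.1 hev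
  have hmem : ∀ i, ∀ s ∈ Icc 0 (δ / 2), s • v i ∈ Metric.ball (0 : ℂ) δ := fun i s hs => by
    rw [mem_ball_zero_iff, norm_smul, hv1, mul_one, Real.norm_of_nonneg hs.1]
    linarith [hs.2]
  refine not_tripod_injective (β := fun i s => b (e.symm (s • v i))) (y := b x) (half_pos hδ) ?_ ?_ ?_
  · intro i
    refine hb.comp (t := U) (e.continuousOn_symm.comp (t := e.target) (by fun_prop) ?_) ?_
    · exact fun s hs => (hball _ (hmem i s hs)).1
    · exact fun s hs => interior_subset (hball _ (hmem i s hs)).2.1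
  · intro i; simp [hx0]
  · intro i j s hs s' hs' heq
    obtain ⟨t1, u1, l1⟩ := hball _ (hmem i s hs)
    obtain ⟨t2, u2, l2⟩ := hball _ (hmem j s' hs')
    have h1 := l1 i s (e.right_inv t1)
    have h2 := l2 j s' (e.right_inv t2)
    have h3 : e.symm (s • v i) = e.symm (s' • v j) :=
      hinj (interior_subset u1) (interior_subset u2) (Prod.ext (h1.trans h2.symm) heq)
    have h4 : s • v i = s' • v j := by
      rw [← e.right_inv t1, h3, e.right_inv t2]
    have h5 : s = s' := by
      have := congrArg norm h4
      rwa [norm_smul, norm_smul, hv1, hv1, mul_one, mul_one, Real.norm_of_nonneg hs.1,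
        Real.norm_of_nonneg hs'.1] at this
    refine ⟨h5, ?_⟩
    by_cases hs0 : s = 0
    · exact Or.inr hs0
    · left
      rw [← h5] at h4
      exact hvinj (smul_right_injective ℂ hs0 h4)

/-! ### Plane topology: winding numbers and invariance of domain -/

/-- A continuous function on a closed disc that restricts to a translation on the boundary circle,
the translation moving the center to a point of the disc, has a zero. -/
theorem exists_eq_zero_of_eq_sub_on_sphere {F : ℂ → ℂ} {ρ : ℝ} {a : ℂ} (hρ : 0 < ρ)
    (hF : ContinuousOn F (Metric.closedBall 0 ρ)) (ha : ‖a‖ < ρ)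
    (hs : ∀ ζ, ‖ζ‖ = ρ → F ζ = ζ - a) : ∃ ζ ∈ Metric.closedBall (0 : ℂ) ρ, F ζ = 0 := by
  by_contra! hne
  -- Precomposing with the radial retraction onto the disc extends `F` to a nowhere vanishing
  -- function on the plane, which has a continuous logarithm.
  set r : ℂ → ℂ := fun ζ => (ρ / max ρ ‖ζ‖) • ζ with hr
  have hmax : ∀ ζ : ℂ, 0 < max ρ ‖ζ‖ := fun ζ => lt_max_of_lt_left hρ
  have hrc : Continuous r := by
    have h : Continuous fun ζ : ℂ => ρ / max ρ ‖ζ‖ :=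
      Continuous.div continuous_const (by fun_prop) fun ζ => (hmax ζ).ne'
    exact h.smul continuous_id
  have hrm : ∀ ζ, r ζ ∈ Metric.closedBall (0 : ℂ) ρ := fun ζ => by
    rw [mem_closedBall_zero_iff, hr, norm_smul, Real.norm_of_nonneg (by positivity),
      div_mul_eq_mul_div, div_le_iff₀ (hmax ζ)]
    exact mul_le_mul_of_nonneg_left (le_max_right _ _) hρ.le
  have hrid : ∀ ζ, ‖ζ‖ = ρ → r ζ = ζ := fun ζ h => by
    rw [hr]
    simp only [h, max_self, div_self hρ.ne', one_smul]
  let G : C(ℂ, ℂ) := ⟨fun ζ => F (r ζ), hF.comp_continuous hrc hrm⟩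
  obtain ⟨L, ⟨-, hL⟩, -⟩ := Complex.isCoveringMapOn_exp.existsUnique_continuousMap_lifts G
    (a₀ := 0) (e₀ := Complex.log (G 0)) (Complex.exp_log (hne _ (hrm 0))) fun ζ => hne _ (hrm ζ)
  set c : ℝ → ℂ := fun θ => ρ * Complex.exp (θ * Complex.I) with hc
  have hcn : ∀ θ, ‖c θ‖ = ρ := fun θ => by
    simp [hc, Complex.norm_exp_ofReal_mul_I, abs_of_pos hρ]
  have hcc : Continuous c := by fun_prop
  have hc0 : ∀ θ, c θ ≠ 0 := fun θ h => by simpa [h, hρ.ne] using hcn θ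
  have hslit : ∀ θ, 1 - a / c θ ∈ Complex.slitPlane := fun θ => by
    refine Complex.mem_slitPlane_of_norm_lt_one (z := -(a / c θ)) ?_
    rw [norm_neg, norm_div, hcn, div_lt_one hρ]
    exact ha
  -- The difference between the logarithm of `F` and the branch `log ρ + iθ + log (1 - a/ζ)` of `log
  -- (ζ - a)`. It is continuous with values in `2πiℤ`, yet it drops by `2πi` over one turn.
  set m : ℝ → ℂ := fun θ => L (c θ) - Complex.log (1 - a / c θ) - Complex.log ρ - θ * Complex.I with hm
  have hmc : Continuous m := by
    refine ((Continuous.sub (L.continuous.comp hcc) ?_).sub continuous_const).sub (by fun_prop)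
    exact Continuous.clog (continuous_const.sub (continuous_const.div hcc hc0)) hslit
  have hexp : ∀ θ, Complex.exp (m θ) = 1 := fun θ => by
    have h1 : Complex.exp (L (c θ)) = c θ - a := by
      have := congrFun hL (c θ)
      simp only [Function.comp, G, ContinuousMap.coe_mk] at this
      rw [this, hrid _ (hcn θ), hs _ (hcn θ)]
    have h2 : 1 - a / c θ ≠ 0 := Complex.slitPlane_ne_zero (hslit θ)
    have h3 : (ρ : ℂ) ≠ 0 := by exact_mod_cast hρ.ne'
    rw [hm]
    simp only [Complex.exp_sub, h1, Complex.exp_log h2, Complex.exp_log h3]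
    rw [div_div, div_div, div_eq_one_iff_eq (by
      refine mul_ne_zero h2 (mul_ne_zero h3 (Complex.exp_ne_zero _)))]
    have : ↑ρ * Complex.exp (θ * Complex.I) = c θ := rfl
    rw [this, sub_mul, one_mul, div_mul_cancel₀ _ (hc0 θ)]
  have hint : ∀ θ, ∃ n : ℤ, (m θ).im / (2 * Real.pi) = n := fun θ => by
    obtain ⟨n, hn⟩ := Complex.exp_eq_one_iff.1 (hexp θ)
    refine ⟨n, ?_⟩
    rw [hn]
    have := Real.pi_pos
    simp
  have hper : (m (2 * Real.pi)).im / (2 * Real.pi) = (m 0).im / (2 * Real.pi) - 1 := by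
    have h1 : c (2 * Real.pi) = c 0 := by simp [hc]
    have h2 : m (2 * Real.pi) = m 0 - 2 * Real.pi * Complex.I := by
      rw [hm]
      simp only [h1]
      push_cast
      ring
    rw [h2]
    have := Real.pi_pos
    simp
    field_simp
  have hivt := intermediate_value_Icc' (f := fun θ => (m θ).im / (2 * Real.pi))
    (a := 0) (b := 2 * Real.pi) (by positivity) (by fun_prop)
  obtain ⟨θ, -, hθ⟩ := hivt (show (m 0).im / (2 * Real.pi) - 1 / 2 ∈ _ from
    ⟨by rw [hper]; linarith, by linarith⟩)
  obtain ⟨n, hn⟩ := hint θ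
  obtain ⟨n', hn'⟩ := hint 0
  simp only at hθ
  rw [hn, hn'] at hθ
  have h1 : ((2 * n : ℤ) : ℝ) = ((2 * n' - 1 : ℤ) : ℝ) := by push_cast; linarith
  have h2 := Int.cast_injective h1
  omega

/-- Invariance of domain for a plane embedding with a differentiable left inverse. -/
theorem image_closedBall_mem_nhds {φ q : ℂ → ℂ} {w₀ : ℂ} {ρ : ℝ} (hρ : 0 < ρ)
    (hφ : ContinuousOn φ (Metric.closedBall w₀ ρ)) {W : Set ℂ} (hW : IsOpen W)
    (hφW : MapsTo φ (Metric.closedBall w₀ ρ) W) (hq : DifferentiableOn ℝ q W)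
    (hinv : ∀ w ∈ Metric.closedBall w₀ ρ, q (φ w) = w) :
    φ '' Metric.closedBall w₀ ρ ∈ 𝓝 (φ w₀) := by
  by_contra hn
  set K := φ '' Metric.closedBall w₀ ρ with hK
  have hw₀ : w₀ ∈ Metric.closedBall w₀ ρ := Metric.mem_closedBall_self hρ.le
  have hKc : IsCompact K := (isCompact_closedBall w₀ ρ).image_of_continuousOn hφ
  have hSc : IsCompact (φ '' Metric.sphere w₀ ρ) :=
    (isCompact_sphere w₀ ρ).image_of_continuousOn (hφ.mono Metric.sphere_subset_closedBall)
  have hcS : φ w₀ ∉ φ '' Metric.sphere w₀ ρ := by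
    rintro ⟨w, hw, h⟩
    have h1 := hinv w (Metric.sphere_subset_closedBall hw)
    rw [h, hinv w₀ hw₀] at h1
    rw [← h1, Metric.mem_sphere, dist_self] at hw
    exact hρ.ne hw
  obtain ⟨ε', hε', hball⟩ := Metric.mem_nhds_iff.1
    ((hW.inter hSc.isClosed.isOpen_compl).mem_nhds ⟨hφW hw₀, hcS⟩)
  set ε := ε' / 3 with hε
  have hεpos : 0 < ε := by positivity
  obtain ⟨p, hp, hpK⟩ : ∃ p, dist p (φ w₀) < ε ∧ p ∉ K := by
    by_contra! h
    exact hn (Metric.mem_nhds_iff.2 ⟨ε, hεpos, fun y hy => h y hy⟩)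
  have hsW : Metric.sphere p ε ⊆ W := fun y hy => (hball (by
    rw [Metric.mem_ball]
    have := dist_triangle y p (φ w₀)
    rw [Metric.mem_sphere] at hy
    linarith)).1
  -- the part of the image away from `p`
  have hfarc : IsCompact (K ∩ {y | ε ≤ dist y p}) :=
    hKc.inter_right (isClosed_le continuous_const (by fun_prop))
  have hKW : K ⊆ W := by rintro _ ⟨w, hw, rfl⟩; exact hφW hw
  have hqne : ∀ y ∈ K ∩ {y | ε ≤ dist y p}, q y ≠ w₀ := by
    rintro _ ⟨⟨w, hw, rfl⟩, hy⟩ h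
    rw [hinv w hw] at h
    rw [h, mem_ofPred_eq, dist_comm] at hy
    linarith
  obtain ⟨η, hη, hηq⟩ : ∃ η > 0, ∀ y ∈ K ∩ {y | ε ≤ dist y p}, η ≤ dist (q y) w₀ := by
    rcases (K ∩ {y | ε ≤ dist y p}).eq_empty_or_nonempty with h | h
    · exact ⟨1, one_pos, by simp [h]⟩
    · obtain ⟨y, hy, hmin⟩ := hfarc.exists_isMinOn h
        (f := fun y => dist (q y) w₀) ((continuous_id.dist continuous_const).comp_continuousOn
          (hq.continuousOn.mono (inter_subset_left.trans hKW)))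
      exact ⟨_, dist_pos.2 (hqne y hy), fun y' hy' => hmin hy'⟩
  -- Differentiability of `q` enters here: the image of the circle is a null set, so it cannot fill
  -- a disc.
  obtain ⟨a, ha, haq⟩ : ∃ a ∈ Metric.ball w₀ (min η ρ), a ∉ q '' Metric.sphere p ε := by
    by_contra! h
    have h0 : MeasureTheory.volume (q '' Metric.sphere p ε) = 0 :=
      MeasureTheory.addHaar_image_eq_zero_of_differentiableOn_of_addHaar_eq_zero _
        (hq.mono hsW) (MeasureTheory.Measure.addHaar_sphere _ _ _)
    have h1 := MeasureTheory.measure_mono_null h h0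
    exact (Metric.measure_ball_pos MeasureTheory.volume w₀ (lt_min hη hρ)).ne' h1
  rw [Metric.mem_ball, lt_min_iff] at ha
  -- Radial push away from the missed point `p`: points inside the circle about `p` move onto it,
  -- the others stay. Then `q ∘ Φ ∘ φ` is the identity on the boundary circle but omits `a`.
  set Φ : ℂ → ℂ := fun y => p + (max 1 (ε / dist y p)) • (y - p) with hΦ
  have hpne : ∀ y ∈ K, y ≠ p := fun y hy h => hpK (h ▸ hy)
  have hΦc : ContinuousOn Φ K := by
    have h1 : ContinuousOn (fun y => ε / dist y p) K :=
      ContinuousOn.div continuousOn_const (by fun_prop) fun y hy => dist_ne_zero.2 (hpne y hy)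
    have h2 : ContinuousOn (fun y => max 1 (ε / dist y p)) K := continuousOn_const.sup h1
    exact continuousOn_const.add (h2.smul (by fun_prop))
  have hΦid : ∀ y ∈ K, ε ≤ dist y p → Φ y = y := fun y hy h => by
    have : ε / dist y p ≤ 1 := (div_le_one (dist_pos.2 (hpne y hy))).2 h
    simp [hΦ, max_eq_left this]
  have hΦs : ∀ y ∈ K, dist y p < ε → Φ y ∈ Metric.sphere p ε := fun y hy h => by
    have hd := dist_pos.2 (hpne y hy)
    have : 1 ≤ ε / dist y p := (one_le_div hd).2 h.le
    rw [Metric.mem_sphere, hΦ]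
    simp only [max_eq_right this]
    rw [dist_eq_norm (p + _), add_sub_cancel_left, norm_smul, ← dist_eq_norm, Real.norm_of_nonneg (by positivity), div_mul_cancel₀ _ hd.ne']
  have hΦW : MapsTo Φ K W := fun y hy => by
    rcases le_or_gt ε (dist y p) with h | h
    · rw [hΦid y hy h]; exact hKW hy
    · exact hsW (hΦs y hy h)
  have hmaps : MapsTo (fun ζ : ℂ => w₀ + ζ) (Metric.closedBall 0 ρ) (Metric.closedBall w₀ ρ) :=
    fun ζ hζ => by simpa [Metric.mem_closedBall, dist_eq_norm] using hζ
  obtain ⟨ζ, hζ, hζ0⟩ := exists_eq_zero_of_eq_sub_on_sphere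
    (F := fun ζ => q (Φ (φ (w₀ + ζ))) - a) (a := a - w₀) hρ
    (((hq.continuousOn.comp hΦc hΦW).comp (hφ.comp (by fun_prop) hmaps)
      (fun ζ hζ => mem_image_of_mem φ (hmaps hζ))).sub continuousOn_const)
    (by rw [← dist_eq_norm]; exact ha.2) (fun ζ hζ => by
      have hζm : w₀ + ζ ∈ Metric.sphere w₀ ρ := by simpa [dist_eq_norm] using hζ
      have hζc := Metric.sphere_subset_closedBall hζm
      have hfar : ε ≤ dist (φ (w₀ + ζ)) p := by
        by_contra! h
        refine (hball (?_ : φ (w₀ + ζ) ∈ _)).2 (mem_image_of_mem φ hζm)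
        rw [Metric.mem_ball]
        have := dist_triangle (φ (w₀ + ζ)) p (φ w₀)
        linarith
      rw [hΦid _ (mem_image_of_mem φ hζc) hfar, hinv _ hζc]
      ring)
  have hy : φ (w₀ + ζ) ∈ K := mem_image_of_mem φ (hmaps hζ)
  rw [sub_eq_zero] at hζ0
  rcases le_or_gt ε (dist (φ (w₀ + ζ)) p) with h | h
  · rw [hΦid _ hy h] at hζ0
    have := hηq _ ⟨hy, h⟩
    rw [hζ0] at this
    linarith [ha.1]
  · exact haq ⟨_, hΦs _ hy h, hζ0⟩

/-! ### Closed forms on starlike domains -/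

/-- Local primitives of a closed form on a starlike open set glue to a global primitive. -/
theorem exists_primitive_of_starConvex {O : Set ℂ} (hO : IsOpen O) {z₀ : ℂ} (hz₀ : z₀ ∈ O)
    (hstar : StarConvex ℝ z₀ O) (P : ℂ → ℂ → ℝ) (hP : ∀ w ∈ O, ContDiffAt ℝ 2 (P w) w)
    (hPP : ∀ w ∈ O, ∀ᶠ w' in 𝓝 w, fderiv ℝ (P w') w' = fderiv ℝ (P w) w') :
    ∃ Q : ℂ → ℝ, ∀ w ∈ O, HasFDerivAt Q (fderiv ℝ (P w) w) w := by
  set η : ℂ → ℂ →L[ℝ] ℝ := fun w => fderiv ℝ (P w) w with hη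
  have hηd : ∀ w ∈ O, HasFDerivAt η (fderiv ℝ (fderiv ℝ (P w)) w) w := fun w hw => by
    have h1 : DifferentiableAt ℝ (fderiv ℝ (P w)) w :=
      ((hP w hw).fderiv_right (m := 1) (by norm_num)).differentiableAt (by norm_num)
    exact h1.hasFDerivAt.congr_of_eventuallyEq (hPP w hw)
  have hsymm : ∀ w ∈ O, ∀ x y, fderiv ℝ (fderiv ℝ (P w)) w x y = fderiv ℝ (fderiv ℝ (P w)) w y x :=
    fun w hw x y => by
      have h := (hP w hw).isSymmSndFDerivAt (by simp)
      exact h x y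
  refine ⟨fun w => curveIntegral η (.segment z₀ w), fun w hw => ?_⟩
  obtain ⟨r, hr, hball⟩ := Metric.isOpen_iff.1 hO w hw
  have hadd : ∀ w' ∈ Metric.ball w r, curveIntegral η (.segment z₀ w') =
      curveIntegral η (.segment z₀ w) + curveIntegral η (.segment w w') := fun w' hw' => by
    -- The triangle stays in `O`: it is the union of the segments from `z₀` to points of `[w, w']`,
    -- and these points lie in the ball about `w`.
    set s := convexHull ℝ {z₀, w, w'} with hs
    have hsO : s ⊆ O := by
      rw [hs, convexHull_insert (by simp), convexHull_pair]
      intro y hy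
      obtain ⟨x, rfl, v, hv, hy⟩ := mem_convexJoin.1 hy
      have hvO : v ∈ O := hball ((convex_ball w r).segment_subset (Metric.mem_ball_self hr) hw' hv)
      exact starConvex_iff_segment_subset.1 hstar hvO hy
    have hsub := subset_convexHull ℝ ({z₀, w, w'} : Set ℂ)
    exact ((convex_convexHull ℝ _).curveIntegral_segment_add_eq_of_hasFDerivWithinAt_symmetric
      (fun x hx => (hηd x (hsO hx)).hasFDerivWithinAt)
      (fun a ha x _ y _ => hsymm a (hsO ha) x y) (hsub (by simp)) (hsub (by simp))
      (hsub (by simp))).symm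
  have h2 : HasFDerivAt (fun w' => curveIntegral η (.segment w w')) (η w) w :=
    HasFDerivAt.curveIntegral_segment_source' ((hO.eventually_mem hw).mono fun x hx =>
      (hηd x hx).continuousAt)
  exact (h2.const_add _).congr_of_eventuallyEq
    (Filter.eventuallyEq_of_mem (Metric.ball_mem_nhds w hr) hadd)

/-! ### Conformal minimal surfaces have harmonic coordinates -/

theorem inner_eq_sum (a b : E3) : inner ℝ a b = a 0 * b 0 + a 1 * b 1 + a 2 * b 2 := by
  simp [PiLp.inner_apply, Fin.sum_univ_three, mul_comm]

/-- A vector orthogonal to `a`, `b` and `a × b` vanishes if `a × b ≠ 0`. -/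
theorem eq_zero_of_inner_cross {a b l : E3} (hab : cross a b ≠ 0) (ha : inner ℝ l a = 0)
    (hb : inner ℝ l b = 0) (hc : inner ℝ l (cross a b) = 0) : l = 0 := by
  have hpos : 0 < inner ℝ (cross a b) (cross a b) := real_inner_self_pos.2 hab
  have hc0 : cross a b 0 = a 1 * b 2 - a 2 * b 1 := by simp [cross, cross_apply]
  have hc1 : cross a b 1 = a 2 * b 0 - a 0 * b 2 := by simp [cross, cross_apply]
  have hc2 : cross a b 2 = a 0 * b 1 - a 1 * b 0 := by simp [cross, cross_apply]
  rw [inner_eq_sum, hc0, hc1, hc2] at hc hpos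
  rw [inner_eq_sum] at ha hb
  have key : ∀ i, l i = 0 := by
    intro i
    -- Cramer's rule in the basis `a`, `b`, `a × b`: each `|a × b|² l i` is a combination of the
    -- three inner products.
    refine (mul_eq_zero.1 (?_ : ((a 1 * b 2 - a 2 * b 1) * (a 1 * b 2 - a 2 * b 1) +
      (a 2 * b 0 - a 0 * b 2) * (a 2 * b 0 - a 0 * b 2) +
      (a 0 * b 1 - a 1 * b 0) * (a 0 * b 1 - a 1 * b 0)) * l i = 0)).resolve_left hpos.ne'
    fin_cases i
    · change _ * l 0 = 0
      linear_combination (a 1 * b 2 - a 2 * b 1) * hc +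
        ((b 0 ^ 2 + b 1 ^ 2 + b 2 ^ 2) * a 0 - (a 0 * b 0 + a 1 * b 1 + a 2 * b 2) * b 0) * ha +
        ((a 0 ^ 2 + a 1 ^ 2 + a 2 ^ 2) * b 0 - (a 0 * b 0 + a 1 * b 1 + a 2 * b 2) * a 0) * hb
    · change _ * l 1 = 0
      linear_combination (a 2 * b 0 - a 0 * b 2) * hc +
        ((b 0 ^ 2 + b 1 ^ 2 + b 2 ^ 2) * a 1 - (a 0 * b 0 + a 1 * b 1 + a 2 * b 2) * b 1) * ha +
        ((a 0 ^ 2 + a 1 ^ 2 + a 2 ^ 2) * b 1 - (a 0 * b 0 + a 1 * b 1 + a 2 * b 2) * a 1) * hb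
    · change _ * l 2 = 0
      linear_combination (a 0 * b 1 - a 1 * b 0) * hc +
        ((b 0 ^ 2 + b 1 ^ 2 + b 2 ^ 2) * a 2 - (a 0 * b 0 + a 1 * b 1 + a 2 * b 2) * b 2) * ha +
        ((a 0 ^ 2 + a 1 ^ 2 + a 2 ^ 2) * b 2 - (a 0 * b 0 + a 1 * b 1 + a 2 * b 2) * a 2) * hb
  ext i
  simpa using key i

theorem inner_cross_self (a b : E3) : inner ℝ (cross a b) (cross a b) =
    inner ℝ a a * inner ℝ b b - inner ℝ a b ^ 2 := by
  simp only [inner_eq_sum]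
  simp [cross, cross_apply]
  ring

/-- The relations `E = G` and `F = 0` between the coefficients of the first fundamental form. -/
def IsWeaklyConformalAt (F : ℂ → E3) (x : ℂ) : Prop :=
  inner ℝ (du F x) (du F x) = inner ℝ (dv F x) (dv F x) ∧ inner ℝ (du F x) (dv F x) = 0

theorem isWeaklyConformalAt_of_conformalAt {F : ℂ → E3} {x : ℂ} (h : ConformalAt F x) :
    IsWeaklyConformalAt F x := by
  obtain ⟨c, -, hc⟩ := conformalAt_iff'.1 h
  simp only [IsWeaklyConformalAt, du, dv, hc]
  simp

/-- A conformally parametrized surface with zero mean curvature is harmonic. -/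
theorem laplacian_eq_zero_of_meanCurvature_eq_zero {F : ℂ → E3} {x : ℂ} (hF : ContDiffAt ℝ 2 F x)
    (hc : ∀ᶠ ζ in 𝓝 x, ConformalAt F ζ) (hH : meanCurvature F x = 0) : Δ F x = 0 := by
  have hw : ∀ᶠ ζ in 𝓝 x, IsWeaklyConformalAt F ζ := hc.mono fun ζ h =>
    isWeaklyConformalAt_of_conformalAt h
  obtain ⟨c, hcpos, hcx⟩ := conformalAt_iff'.1 hc.self_of_nhds
  have hE : inner ℝ (du F x) (du F x) = c := by
    simp only [du, hcx]; simp
  have hG : inner ℝ (dv F x) (dv F x) = c := by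
    simp only [dv, hcx]; simp
  have hFF : inner ℝ (du F x) (dv F x) = 0 := by
    simp only [du, dv, hcx]; simp
  have h2 : DifferentiableAt ℝ (fderiv ℝ F) x :=
    (hF.fderiv_right (m := 1) (by norm_num)).differentiableAt (by norm_num)
  set D := fderiv ℝ (fderiv ℝ F) x with hD
  have hdv' : ∀ v : ℂ, HasFDerivAt (fun ζ => fderiv ℝ F ζ v)
      ((ContinuousLinearMap.apply ℝ E3 v).comp D) x := fun v =>
    (ContinuousLinearMap.apply ℝ E3 v).hasFDerivAt.comp x h2.hasFDerivAt
  have hsymm : D 1 Complex.I = D Complex.I 1 := hF.isSymmSndFDerivAt (by simp) 1 Complex.I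
  -- Derivatives of the conformality relations. With the symmetry of `D` they make the Laplacian
  -- orthogonal to both tangent vectors; its normal component is a multiple of the mean curvature.
  have e1 : ∀ v, inner ℝ (du F x) (D v Complex.I) + inner ℝ (D v 1) (dv F x) = 0 := fun v => by
    have h3 := (hdv' 1).inner ℝ (hdv' Complex.I)
    have h4 := h3.congr_of_eventuallyEq (f₁ := fun _ => (0 : ℝ))
      (hw.mono fun ζ h => h.2.symm)
    have h5 := h4.unique (hasFDerivAt_const (0 : ℝ) x)
    have h6 := DFunLike.congr_fun h5 v
    simpa [du, dv] using h6
  have e2 : ∀ v, inner ℝ (du F x) (D v 1) = inner ℝ (dv F x) (D v Complex.I) := fun v => by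
    have h3 := (hdv' 1).inner ℝ (hdv' 1)
    have h3' := (hdv' Complex.I).inner ℝ (hdv' Complex.I)
    have h4 := h3.congr_of_eventuallyEq (f₁ := fun ζ => inner ℝ (dv F ζ) (dv F ζ))
      (hw.mono fun ζ h => h.1.symm)
    have h5 := h4.unique h3'
    have h6 := DFunLike.congr_fun h5 v
    simp [du, dv] at h6 ⊢
    rw [real_inner_comm _ ((D v) 1), real_inner_comm _ ((D v) Complex.I)] at h6
    linarith
  have hlap : Δ F x = D 1 1 + D Complex.I Complex.I := by
    rw [laplacian_eq_iteratedFDeriv_complexPlane]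
    simp only [iteratedFDeriv_two_apply]
    simp [hD]
  have hcr : cross (du F x) (dv F x) ≠ 0 := by
    intro h
    have h3 := inner_cross_self (du F x) (dv F x)
    rw [h, hE, hG, hFF] at h3
    simp at h3
    exact hcpos.ne' h3
  have hnorm : ‖cross (du F x) (dv F x)‖ ≠ 0 := norm_ne_zero_iff.2 hcr
  rw [hlap]
  refine eq_zero_of_inner_cross hcr ?_ ?_ ?_
  · have := e1 Complex.I
    have h7 := e2 1
    rw [inner_add_left, real_inner_comm, real_inner_comm (du F x) (D Complex.I Complex.I), h7]
    rw [← hsymm, real_inner_comm (dv F x)] at this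
    linarith
  · have := e1 1
    have h7 := e2 Complex.I
    rw [inner_add_left, real_inner_comm (dv F x) (D Complex.I Complex.I), ← h7, ← hsymm]
    linarith
  · have hduu : du (du F) x = D 1 1 := by
      have h8 := (hdv' 1).fderiv
      change fderiv ℝ (fun ζ => fderiv ℝ F ζ 1) x 1 = _
      rw [h8]; rfl
    have hdvv : dv (dv F) x = D Complex.I Complex.I := by
      have h8 := (hdv' Complex.I).fderiv
      change fderiv ℝ (fun ζ => fderiv ℝ F ζ Complex.I) x Complex.I = _
      rw [h8]; rfl
    rw [meanCurvature, hE, hG, hFF, hduu, hdvv, div_eq_zero_iff] at hH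
    rcases hH with h | h
    · simp only [unitNormal, inner_smul_right, mul_zero, sub_zero] at h
      rw [inner_add_left]
      field_simp at h
      simpa [hcpos.ne'] using h
    · nlinarith

/-! ### The slab barrier -/

/-- The computation behind `laplacian_slabBarrier_neg` along one direction. Summed over the two
coordinate directions, the second derivatives of the harmonic functions `A`, `C`, `T` cancel and
only first derivatives remain. -/
theorem deriv_deriv_half_log_sub_sq {A C T : ℝ → ℝ} (hA : ContDiffAt ℝ 2 A 0)
    (hC : ContDiffAt ℝ 2 C 0) (hT : ContDiffAt ℝ 2 T 0) (hρ : A 0 ^ 2 + C 0 ^ 2 ≠ 0) :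
    deriv (deriv fun s => 1 / 2 * Real.log (A s ^ 2 + C s ^ 2) - T s ^ 2) 0 =
      ((deriv A 0 ^ 2 + A 0 * deriv (deriv A) 0 + deriv C 0 ^ 2 + C 0 * deriv (deriv C) 0) *
        (A 0 ^ 2 + C 0 ^ 2) - 2 * (A 0 * deriv A 0 + C 0 * deriv C 0) ^ 2) /
        (A 0 ^ 2 + C 0 ^ 2) ^ 2 - 2 * (deriv T 0 ^ 2 + T 0 * deriv (deriv T) 0) := by
  have ev : ∀ {f : ℝ → ℝ}, ContDiffAt ℝ 2 f 0 → ∀ᶠ s in 𝓝 0, HasDerivAt f (deriv f s) s :=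
    fun {f} hf => (hf.eventually (by simp)).mono fun s hs =>
      (hs.differentiableAt (by norm_num)).hasDerivAt
  have d2 : ∀ {f : ℝ → ℝ}, ContDiffAt ℝ 2 f 0 → HasDerivAt (deriv f) (deriv (deriv f) 0) 0 :=
    fun {f} hf => by
      have h1 : ContDiffAt ℝ 1 (fderiv ℝ f) 0 := hf.fderiv_right (m := 1) (by norm_num)
      have h2 : DifferentiableAt ℝ (fun s => fderiv ℝ f s 1) 0 :=
        (h1.differentiableAt (by norm_num)).clm_apply (differentiableAt_const _)
      have h3 : (fun s => fderiv ℝ f s 1) = deriv f := by ext s; simp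
      rw [h3] at h2
      exact h2.hasDerivAt
  have hρ' : ∀ᶠ s in 𝓝 0, A s ^ 2 + C s ^ 2 ≠ 0 :=
    ((hA.continuousAt.pow 2).add (hC.continuousAt.pow 2)).eventually_ne hρ
  have h1 : (deriv fun s => 1 / 2 * Real.log (A s ^ 2 + C s ^ 2) - T s ^ 2) =ᶠ[𝓝 0]
      fun s => (A s * deriv A s + C s * deriv C s) / (A s ^ 2 + C s ^ 2) - 2 * (T s * deriv T s) := by
    filter_upwards [ev hA, ev hC, ev hT, hρ'] with s hAs hCs hTs hρs
    have := ((((hAs.fun_pow 2).fun_add (hCs.fun_pow 2)).log hρs).const_mul (1 / 2)).fun_sub (hTs.fun_pow 2)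
    rw [this.deriv]
    field_simp
    ring
  rw [h1.deriv_eq]
  have hA0 := (ev hA).self_of_nhds
  have hC0 := (ev hC).self_of_nhds
  have hT0 := (ev hT).self_of_nhds
  have h2 := (((hA0.fun_mul (d2 hA)).fun_add (hC0.fun_mul (d2 hC))).fun_div
    ((hA0.fun_pow 2).fun_add (hC0.fun_pow 2)) hρ).fun_sub ((hT0.fun_mul (d2 hT)).const_mul 2)
  rw [h2.deriv]
  congr 1
  · congr 1
    ring
  · ring

/-- Bessel's inequality for two orthogonal vectors of equal norm, in coordinates. -/
theorem sq_add_sq_le_of_orthogonal {u0 u1 u2 v0 v1 v2 n0 n2 l : ℝ}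
    (hu : u0 * u0 + u1 * u1 + u2 * u2 = l) (hv : v0 * v0 + v1 * v1 + v2 * v2 = l)
    (huv : u0 * v0 + u1 * v1 + u2 * v2 = 0) :
    (n0 * u0 + n2 * u2) ^ 2 + (n0 * v0 + n2 * v2) ^ 2 ≤ (n0 ^ 2 + n2 ^ 2) * l := by
  have hl : 0 ≤ l := by rw [← hu]; nlinarith [sq_nonneg u0, sq_nonneg u1, sq_nonneg u2]
  rcases hl.eq_or_lt with h | h
  · have h0 : u0 = 0 ∧ u2 = 0 := by constructor <;> nlinarith [sq_nonneg u0, sq_nonneg u1, sq_nonneg u2]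
    have h1 : v0 = 0 ∧ v2 = 0 := by constructor <;> nlinarith [sq_nonneg v0, sq_nonneg v1, sq_nonneg v2]
    rw [h0.1, h0.2, h1.1, h1.2, ← h]
    simp
  · refine le_of_mul_le_mul_left ?_ h
    -- The defect is the squared component of `(n0, 0, n2)` along `u × v`.
    have key : l * ((n0 ^ 2 + n2 ^ 2) * l) - l * ((n0 * u0 + n2 * u2) ^ 2 + (n0 * v0 + n2 * v2) ^ 2)
        = (n0 * (u1 * v2 - u2 * v1) + n2 * (u0 * v1 - u1 * v0)) ^ 2 := by
      linear_combination (-(v0 * v0 + v1 * v1 + v2 * v2) * (n0 ^ 2 + n2 ^ 2) +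
          (n0 * v0 + n2 * v2) ^ 2) * hu +
        (-l * (n0 ^ 2 + n2 ^ 2) + (n0 * u0 + n2 * u2) ^ 2) * hv +
        ((n0 ^ 2 + n2 ^ 2) * (u0 * v0 + u1 * v1 + u2 * v2) -
          2 * (n0 * u0 + n2 * u2) * (n0 * v0 + n2 * v2)) * huv
    nlinarith [sq_nonneg (n0 * (u1 * v2 - u2 * v1) + n2 * (u0 * v1 - u1 * v0))]

/-- The function `log r - t ^ 2` along a parametrized surface, where `t` is the second coordinate
relative to `t₀` and `r` the distance to the line `x₁ = 0`, `x₃ = h`. -/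
noncomputable def slabBarrier (F : ℂ → E3) (h t₀ : ℝ) (ζ : ℂ) : ℝ :=
  1 / 2 * Real.log (F ζ 0 ^ 2 + (F ζ 2 - h) ^ 2) - (F ζ 1 - t₀) ^ 2

/-- On a conformally parametrized minimal surface, `log r - t ^ 2` is strictly superharmonic where
`r ≥ 1`, `r` being the distance to a line parallel to the `t`-axis. -/
theorem laplacian_slabBarrier_neg {F : ℂ → E3} {x : ℂ} (hF : ContDiffAt ℝ 2 F x)
    (hlap : Δ F x = 0) (hw : IsWeaklyConformalAt F x) (h t₀ : ℝ)
    (hr : 1 ≤ F x 0 ^ 2 + (F x 2 - h) ^ 2) (ht : fderiv ℝ (fun ζ => F ζ 1) x ≠ 0) :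
    ContDiffAt ℝ 2 (slabBarrier F h t₀) x ∧ Δ (slabBarrier F h t₀) x < 0 := by
  have hcoord : ∀ i, ContDiffAt ℝ 2 (fun ζ => F ζ i) x := fun i =>
    (EuclideanSpace.proj (𝕜 := ℝ) i).contDiff.contDiffAt.comp x hF
  have hlapi : ∀ i, Δ (fun ζ => F ζ i : ℂ → ℝ) x = 0 := fun i => by
    have := hF.laplacian_CLM_comp_left (l := EuclideanSpace.proj (𝕜 := ℝ) i)
    have h2 : (EuclideanSpace.proj (𝕜 := ℝ) i ∘ F) = fun ζ => F ζ i := rfl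
    rw [h2] at this
    rw [this]
    simp [hlap]
  have hfd : ∀ i v, fderiv ℝ (fun ζ => F ζ i) x v = fderiv ℝ F x v i := fun i v => by
    have := ((EuclideanSpace.proj (𝕜 := ℝ) i).hasFDerivAt.comp x
      (hF.differentiableAt (by norm_num)).hasFDerivAt).fderiv
    have h2 : (EuclideanSpace.proj (𝕜 := ℝ) i ∘ F) = fun ζ => F ζ i := rfl
    rw [h2] at this
    rw [this]
    rfl
  set a : ℂ → ℝ := fun ζ => F ζ 0 with ha
  set c : ℂ → ℝ := fun ζ => F ζ 2 - h with hc
  set t : ℂ → ℝ := fun ζ => F ζ 1 - t₀ with ht'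
  have hca : ContDiffAt ℝ 2 a x := hcoord 0
  have hcc : ContDiffAt ℝ 2 c x := (hcoord 2).sub contDiffAt_const
  have hct : ContDiffAt ℝ 2 t x := (hcoord 1).sub contDiffAt_const
  have hρ : a x ^ 2 + c x ^ 2 ≠ 0 := by
    have : (1 : ℝ) ≤ a x ^ 2 + c x ^ 2 := hr
    linarith
  have hG : ContDiffAt ℝ 2 (slabBarrier F h t₀) x :=
    (contDiffAt_const.mul (((hca.pow 2).add (hcc.pow 2)).log hρ)).sub (hct.pow 2)
  refine ⟨hG, ?_⟩
  have hline : ∀ (v : ℂ) {f : ℂ → ℝ}, ContDiffAt ℝ 2 f x →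
      ContDiffAt ℝ 2 (fun s : ℝ => f (x + s • v)) 0 := fun v f hf => by
    have h1 : ContDiffAt ℝ 2 (fun s : ℝ => x + s • v) 0 := by fun_prop
    exact ContDiffAt.comp (g := f) (0 : ℝ) (by simpa using hf) h1
  have hd1 : ∀ (v : ℂ) {f : ℂ → ℝ}, ContDiffAt ℝ 2 f x →
      deriv (fun s : ℝ => f (x + s • v)) 0 = fderiv ℝ f x v := fun v f hf => by
    have h1 : HasFDerivAt f (fderiv ℝ f x) (x + (0 : ℝ) • v) := by
      rw [zero_smul, add_zero]; exact (hf.differentiableAt (by norm_num)).hasFDerivAt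
    exact (h1.comp_hasDerivAt (0 : ℝ) (hasDerivAt_line x v 0)).deriv
  have hlapeq : ∀ {f : ℂ → ℝ}, ContDiffAt ℝ 2 f x → Δ f x =
      deriv (deriv fun s : ℝ => f (x + s • (1 : ℂ))) 0 +
      deriv (deriv fun s : ℝ => f (x + s • Complex.I)) 0 := fun {f} hf => by
    rw [laplacian_eq_iteratedFDeriv_complexPlane]
    simp only
    rw [iteratedFDeriv_two_apply_self hf, iteratedFDeriv_two_apply_self hf]
  have key : ∀ v : ℂ, deriv (deriv fun s : ℝ => slabBarrier F h t₀ (x + s • v)) 0 = _ := fun v =>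
    deriv_deriv_half_log_sub_sq (A := fun s : ℝ => a (x + s • v)) (C := fun s : ℝ => c (x + s • v))
      (T := fun s : ℝ => t (x + s • v)) (hline v hca) (hline v hcc) (hline v hct) (by simpa using hρ)
  have hlc : Δ c x = 0 := by
    have := (hcoord 2).laplacian_sub (contDiffAt_const (c := h))
    have h2 : ((fun ζ => F ζ 2) - fun _ => h) = c := rfl
    rw [h2, hlapi 2] at this
    simpa using this
  have hlt : Δ t x = 0 := by
    have := (hcoord 1).laplacian_sub (contDiffAt_const (c := t₀))
    have h2 : ((fun ζ => F ζ 1) - fun _ => t₀) = t := rfl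
    rw [h2, hlapi 1] at this
    simpa using this
  have hla : Δ a x = 0 := hlapi 0
  rw [hlapeq hca] at hla
  rw [hlapeq hcc] at hlc
  rw [hlapeq hct] at hlt
  rw [hlapeq hG, key 1, key Complex.I]
  simp only [hd1 _ hca, hd1 _ hcc, hd1 _ hct, zero_smul, add_zero]
  set a1 := deriv (deriv fun s : ℝ => a (x + s • (1 : ℂ))) 0
  set a2 := deriv (deriv fun s : ℝ => a (x + s • Complex.I)) 0
  set c1 := deriv (deriv fun s : ℝ => c (x + s • (1 : ℂ))) 0
  set c2 := deriv (deriv fun s : ℝ => c (x + s • Complex.I)) 0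
  set t1 := deriv (deriv fun s : ℝ => t (x + s • (1 : ℂ))) 0
  set t2 := deriv (deriv fun s : ℝ => t (x + s • Complex.I)) 0
  have hfa : ∀ v, fderiv ℝ a x v = fderiv ℝ F x v 0 := hfd 0
  have hfc : ∀ v, fderiv ℝ c x v = fderiv ℝ F x v 2 := fun v => by
    simp only [hc, fderiv_sub_const]; exact hfd 2 v
  have hft : ∀ v, fderiv ℝ t x v = fderiv ℝ F x v 1 := fun v => by
    simp only [ht', fderiv_sub_const]; exact hfd 1 v
  simp only [hfa, hfc, hft]
  obtain ⟨hE, hFF⟩ := hw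
  simp only [inner_eq_sum, du, dv] at hE hFF
  have htne : 0 < fderiv ℝ F x 1 1 ^ 2 + fderiv ℝ F x Complex.I 1 ^ 2 := by
    by_contra! hcon
    have h1 : fderiv ℝ F x 1 1 = 0 := by
      nlinarith [sq_nonneg (fderiv ℝ F x 1 1), sq_nonneg (fderiv ℝ F x Complex.I 1)]
    have h2 : fderiv ℝ F x Complex.I 1 = 0 := by
      nlinarith [sq_nonneg (fderiv ℝ F x 1 1), sq_nonneg (fderiv ℝ F x Complex.I 1)]
    apply ht
    ext v
    have hv : v = v.re • (1 : ℂ) + v.im • Complex.I := by simp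
    rw [hfd, hv, map_add, map_smul, map_smul]
    simp [h1, h2]
  have hr' : 1 ≤ a x ^ 2 + c x ^ 2 := hr
  clear_value a1 a2 c1 c2 t1 t2 a c t
  clear hfa hfc hft key hlapeq hd1 hline hG hct hcc hca hfd hlapi hcoord hr ha hc ht' hlap hF ht
  generalize fderiv ℝ F x 1 0 = u0 at *
  generalize fderiv ℝ F x 1 1 = u1 at *
  generalize fderiv ℝ F x 1 2 = u2 at *
  generalize fderiv ℝ F x Complex.I 0 = v0 at *
  generalize fderiv ℝ F x Complex.I 1 = v1 at *
  generalize fderiv ℝ F x Complex.I 2 = v2 at *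
  generalize a x = A at *
  generalize c x = C at *
  generalize t x = T at *
  -- `(C, 0, -A)` is the angular direction about the axis, perpendicular to the radial `(A, 0, C)`.
  -- Bounding the angular derivatives bounds the radial ones from below, which yields the estimate
  -- `hnum` by `ρ |∇t|²`.
  have hb := sq_add_sq_le_of_orthogonal (n0 := C) (n2 := -A) hE.symm.symm rfl hFF
  obtain ⟨ρ, hρdef⟩ : ∃ ρ, ρ = A ^ 2 + C ^ 2 := ⟨_, rfl⟩
  rw [← hρdef] at hr' ⊢
  have hρ0 : 0 < ρ := by linarith
  have hexpr : ((u0 ^ 2 + A * a1 + u2 ^ 2 + C * c1) * ρ - 2 * (A * u0 + C * u2) ^ 2) / ρ ^ 2 -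
      2 * (u1 ^ 2 + T * t1) +
      (((v0 ^ 2 + A * a2 + v2 ^ 2 + C * c2) * ρ - 2 * (A * v0 + C * v2) ^ 2) / ρ ^ 2 -
      2 * (v1 ^ 2 + T * t2)) =
      ((u0 ^ 2 + u2 ^ 2 + v0 ^ 2 + v2 ^ 2) * ρ -
        2 * ((A * u0 + C * u2) ^ 2 + (A * v0 + C * v2) ^ 2)) / ρ ^ 2 - 2 * (u1 ^ 2 + v1 ^ 2) := by
    have e1 : a2 = -a1 := by linarith
    have e2 : c2 = -c1 := by linarith
    have e3 : t2 = -t1 := by linarith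
    rw [e1, e2, e3]
    ring
  rw [hexpr]
  have hnum : (u0 ^ 2 + u2 ^ 2 + v0 ^ 2 + v2 ^ 2) * ρ -
        2 * ((A * u0 + C * u2) ^ 2 + (A * v0 + C * v2) ^ 2) ≤ ρ * (u1 ^ 2 + v1 ^ 2) := by
    have hE' : (A ^ 2 + C ^ 2) * (u0 * u0 + u1 * u1 + u2 * u2) =
        (A ^ 2 + C ^ 2) * (v0 * v0 + v1 * v1 + v2 * v2) := by rw [hE]
    rw [hρdef]
    linarith
  have h3 : ((u0 ^ 2 + u2 ^ 2 + v0 ^ 2 + v2 ^ 2) * ρ -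
        2 * ((A * u0 + C * u2) ^ 2 + (A * v0 + C * v2) ^ 2)) / ρ ^ 2 ≤ u1 ^ 2 + v1 ^ 2 := by
    rw [div_le_iff₀ (by positivity)]
    refine hnum.trans ?_
    nlinarith [mul_nonneg hρ0.le htne.le, mul_nonneg (mul_nonneg hρ0.le htne.le) (sub_nonneg.2 hr')]
  linarith

/-! ### Green functions of the slit plane -/

/-- The Green function of the right half-plane with pole `e > 0`. -/
noncomputable def halfPlaneGreen (e : ℝ) (ξ : ℂ) : ℝ := Real.log ‖(ξ + e) / (ξ - e)‖

theorem halfPlaneGreen_nonneg {e : ℝ} (he : 0 < e) {ξ : ℂ} (hξ : 0 ≤ ξ.re) :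
    0 ≤ halfPlaneGreen e ξ := by
  rcases eq_or_ne ξ (e : ℂ) with h | h
  · simp [halfPlaneGreen, h]
  · have hpos : 0 < ‖ξ - e‖ := norm_pos_iff.2 (sub_ne_zero.2 h)
    rw [halfPlaneGreen, norm_div]
    refine Real.log_nonneg ((one_le_div hpos).2 ?_)
    refine (sq_le_sq₀ (norm_nonneg _) (norm_nonneg _)).1 ?_
    rw [← Complex.normSq_eq_norm_sq, ← Complex.normSq_eq_norm_sq, Complex.normSq_apply,
      Complex.normSq_apply]
    simp
    nlinarith [mul_nonneg hξ he.le]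

/-- A conformal map of the complement of the segment `[-r, r]` into the right half-plane. -/
noncomputable def slitSqrt (r : ℝ) (w : ℂ) : ℂ := ((w - r) / (w + r)) ^ (2⁻¹ : ℂ)

/-- Solving `(w - r)/(w + r) = -c` with `c ≥ 0` gives `w = r(1 - c)/(1 + c)`, a point of the slit.
Off the slit the principal square root is therefore analytic. -/
theorem div_mem_slitPlane {r : ℝ} (hr : 0 < r) {w : ℂ} (hw : w ∉ Complex.ofReal '' Icc (-r) r) :
    (w - r) / (w + r) ∈ Complex.slitPlane := by
  by_contra hn
  rw [Complex.mem_slitPlane_iff, not_or, not_lt, not_not] at hn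
  have hne : w + r ≠ 0 := fun h => hw ⟨-r, ⟨le_rfl, by linarith⟩, by
    rw [Complex.ofReal_neg]; exact (eq_neg_of_add_eq_zero_left h).symm⟩
  obtain ⟨c, hc0, hc⟩ : ∃ c : ℝ, 0 ≤ c ∧ (w - r) / (w + r) = ((-c : ℝ) : ℂ) :=
    ⟨-((w - r) / (w + r)).re, by linarith, Complex.ext (by simp) (by simpa using hn.2)⟩
  rw [div_eq_iff hne] at hc
  refine hw ⟨r * (1 - c) / (1 + c), ⟨?_, ?_⟩, ?_⟩
  · rw [le_div_iff₀ (by linarith)]; nlinarith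
  · rw [div_le_iff₀ (by linarith)]; nlinarith
  · have h1 : (1 + c : ℂ) ≠ 0 := by
      have : (1 + c : ℝ) ≠ 0 := by linarith
      exact_mod_cast this
    push_cast at hc ⊢
    rw [div_eq_iff h1]
    linear_combination -hc

theorem add_ne_zero_of_notMem {r : ℝ} (hr : 0 < r) {w : ℂ}
    (hw : w ∉ Complex.ofReal '' Icc (-r) r) : w + r ≠ 0 := fun h =>
  hw ⟨-r, ⟨le_rfl, by linarith⟩, by
    rw [Complex.ofReal_neg]; exact (eq_neg_of_add_eq_zero_left h).symm⟩

theorem slitSqrt_re_nonneg (r : ℝ) (w : ℂ) : 0 ≤ (slitSqrt r w).re := by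
  rw [slitSqrt]
  generalize (w - r) / (w + r) = v
  rcases eq_or_ne v 0 with h | h
  · simp [h]
  · rw [Complex.cpow_def_of_ne_zero h, Complex.exp_re]
    refine mul_nonneg (Real.exp_pos _).le (Real.cos_nonneg_of_mem_Icc ?_)
    have h1 := Complex.neg_pi_lt_arg v
    have h2 := Complex.arg_le_pi v
    have h3 : (Complex.log v * 2⁻¹).im = v.arg / 2 := by
      simp [Complex.mul_im, Complex.log_im]
      ring
    rw [h3]
    constructor <;> linarith

theorem slitSqrt_sq (r : ℝ) (w : ℂ) : slitSqrt r w ^ 2 = (w - r) / (w + r) := by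
  simp [slitSqrt]

theorem slitSqrt_ofReal (r : ℝ) {x : ℝ} (hx : 0 ≤ (x - r) / (x + r)) :
    slitSqrt r x = (√((x - r) / (x + r)) : ℝ) := by
  rw [slitSqrt, Real.sqrt_eq_rpow, Complex.ofReal_cpow hx]
  norm_num

/-- A real Möbius map takes real values only at real points, so a pole can be met only on the real
axis. The exceptional value `e² = 1` corresponds to `w = ∞`. -/
theorem im_eq_zero_of_slitSqrt_eq {r : ℝ} (hr : 0 < r) {w : ℂ}
    (hw : w ∉ Complex.ofReal '' Icc (-r) r) {e : ℝ} (h : slitSqrt r w = e) : w.im = 0 := by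
  have hne := add_ne_zero_of_notMem hr hw
  have h1 := slitSqrt_sq r w
  rw [h, eq_div_iff hne] at h1
  have him := congrArg Complex.im h1
  have hre := congrArg Complex.re h1
  simp [pow_two] at him hre
  by_contra hw0
  have : e * e = 1 := by
    have : (e * e - 1) * w.im = 0 := by linarith
    rcases mul_eq_zero.1 this with h | h
    · linarith
    · exact absurd h hw0
  rw [this] at hre
  linarith

/-- A sum of two Green functions on the complement of the segment `[-r, r]`, extended by zero. -/
noncomputable def slitBarrier (r a b : ℝ) (w : ℂ) : ℝ :=
  open Classical in if w ∈ Complex.ofReal '' Icc (-r) r then 0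
    else halfPlaneGreen a (slitSqrt r w) + halfPlaneGreen b (slitSqrt r w)

theorem slitBarrier_nonneg {r a b : ℝ} (ha : 0 < a) (hb : 0 < b) (w : ℂ) :
    0 ≤ slitBarrier r a b w := by
  rw [slitBarrier]
  split_ifs
  · exact le_rfl
  · exact add_nonneg (halfPlaneGreen_nonneg ha (slitSqrt_re_nonneg r w))
      (halfPlaneGreen_nonneg hb (slitSqrt_re_nonneg r w))

theorem isClosed_ofReal_image_Icc (r : ℝ) : IsClosed (Complex.ofReal '' Icc (-r) r) :=
  (isCompact_Icc.image Complex.continuous_ofReal).isClosed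

theorem harmonicAt_slitBarrier_comp {r a b : ℝ} (hr : 0 < r) {Φ : ℂ → ℂ} {x : ℂ}
    (hΦ : AnalyticAt ℂ Φ x) (hx : Φ x ∉ Complex.ofReal '' Icc (-r) r)
    (hpole : ∀ e ∈ ({a, b} : Set ℝ), slitSqrt r (Φ x) ≠ e) (ha : 0 < a) (hb : 0 < b) :
    HarmonicAt (fun ζ => slitBarrier r a b (Φ ζ)) x := by
  have hξ : AnalyticAt ℂ (fun ζ => slitSqrt r (Φ ζ)) x :=
    ((hΦ.sub analyticAt_const).div (hΦ.add analyticAt_const) (add_ne_zero_of_notMem hr hx)).cpow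
      analyticAt_const (div_mem_slitPlane hr hx)
  have hg : ∀ e ∈ ({a, b} : Set ℝ), 0 < e →
      HarmonicAt (fun ζ => halfPlaneGreen e (slitSqrt r (Φ ζ))) x := fun e he hpos => by
    have h1 : slitSqrt r (Φ x) - e ≠ 0 := sub_ne_zero.2 (hpole e he)
    have h2 : slitSqrt r (Φ x) + e ≠ 0 := fun h => by
      have h3 := congrArg Complex.re h
      simp at h3
      linarith [slitSqrt_re_nonneg r (Φ x)]
    exact AnalyticAt.harmonicAt_log_norm
      ((hξ.add analyticAt_const).div (hξ.sub analyticAt_const) h1) (div_ne_zero h2 h1)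
  have hev : ∀ᶠ ζ in 𝓝 x, Φ ζ ∉ Complex.ofReal '' Icc (-r) r :=
    hΦ.continuousAt.eventually ((isClosed_ofReal_image_Icc r).isOpen_compl.eventually_mem hx)
  refine (harmonicAt_congr_nhds ?_).2 ((hg a (by simp) ha).add (hg b (by simp) hb))
  filter_upwards [hev] with ζ hζ
  simp [slitBarrier, hζ]

/-- The pole is the supremum of `√((x - r)/(x + r))` over `I ∩ (r, ∞)`; it equals 1, the image of
infinity, when `I` is unbounded above. Openness of `I` keeps the supremum from being attained, while
the Green function blows up on approach. -/
theorem exists_pole {r : ℝ} (hr : 0 < r) {I : Set ℝ} (hI : IsOpen I) (hI' : ∃ x ∈ I, r < x) :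
    ∃ b : ℝ, 0 < b ∧ b ≤ 1 ∧ (∀ x ∈ I, r < x → √((x - r) / (x + r)) < b) ∧
      ∀ Λ : ℝ, ∃ x₁ ∈ I, r < x₁ ∧ ∀ x ∈ I, r < x →
        halfPlaneGreen b (√((x - r) / (x + r)) : ℝ) ≤ Λ → x ≤ x₁ := by
  set χ : ℝ → ℝ := fun x => √((x - r) / (x + r)) with hχ
  have hpos : ∀ x, r < x → 0 < χ x := fun x hx =>
    Real.sqrt_pos.2 (div_pos (by linarith) (by linarith))
  have hle1 : ∀ x, r < x → χ x ≤ 1 := fun x hx => by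
    rw [hχ]
    exact Real.sqrt_le_one.2 ((div_le_one (by linarith)).2 (by linarith))
  have hmono : ∀ x y, r < x → x < y → χ x < χ y := fun x y hx hxy => by
    refine Real.sqrt_lt_sqrt (div_nonneg (by linarith) (by linarith)) ?_
    rw [div_lt_div_iff₀ (by linarith) (by linarith)]
    nlinarith
  set S := χ '' (I ∩ Ioi r) with hS
  have hSne : S.Nonempty := by
    obtain ⟨x, hx, hrx⟩ := hI'
    exact ⟨_, x, ⟨hx, hrx⟩, rfl⟩
  have hSb : BddAbove S := ⟨1, by rintro _ ⟨x, ⟨-, hx⟩, rfl⟩; exact hle1 x hx⟩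
  have hlt : ∀ x ∈ I, r < x → χ x < sSup S := fun x hx hrx => by
    obtain ⟨ε, hε, hball⟩ := Metric.isOpen_iff.1 hI x hx
    have hx' : x + ε / 2 ∈ I := hball (by
      rw [Metric.mem_ball, Real.dist_eq, add_sub_cancel_left, abs_of_pos (by positivity)]; linarith)
    exact (hmono x (x + ε / 2) hrx (by linarith)).trans_le
      (le_csSup hSb ⟨_, ⟨hx', by rw [mem_Ioi]; linarith⟩, rfl⟩)
  have hbpos : 0 < sSup S := by
    obtain ⟨x, hx, hrx⟩ := hI'
    exact (hpos x hrx).trans (hlt x hx hrx)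
  refine ⟨sSup S, hbpos, csSup_le hSne ?_, hlt, fun Λ => ?_⟩
  · rintro _ ⟨x, ⟨-, hx⟩, rfl⟩; exact hle1 x hx
  · have hexp := Real.exp_pos (-Λ)
    -- With `b = sSup S`, once `b - χ < b e^(-Λ)` one has `e^Λ (b - χ) < b < χ + b`, so the Green
    -- function exceeds `Λ`.
    obtain ⟨_, ⟨x₁, ⟨hx₁, hr₁⟩, rfl⟩, hx₁'⟩ := exists_lt_of_lt_csSup hSne
      (show sSup S - sSup S * Real.exp (-Λ) < sSup S by nlinarith)
    refine ⟨x₁, hx₁, hr₁, fun x hx hrx hΛ => ?_⟩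
    by_contra! hcon
    have h1 := hmono x₁ x hr₁ hcon
    have h2 := hlt x hx hrx
    have h3 := hpos x hrx
    change halfPlaneGreen (sSup S) ((χ x : ℝ) : ℂ) ≤ Λ at hΛ
    rw [halfPlaneGreen, ← Complex.ofReal_add, ← Complex.ofReal_sub, ← Complex.ofReal_div,
      Complex.norm_real, Real.norm_eq_abs, Real.log_abs] at hΛ
    have h4 : (χ x + sSup S) / (χ x - sSup S) = -((χ x + sSup S) / (sSup S - χ x)) := by
      rw [← div_neg, neg_sub]
    rw [h4, Real.log_neg_eq_log, Real.log_le_iff_le_exp (div_pos (by linarith) (by linarith)),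
      div_le_iff₀ (by linarith)] at hΛ
    have h5 : Real.exp Λ * Real.exp (-Λ) = 1 := by rw [← Real.exp_add]; simp
    have h6 : sSup S - χ x < sSup S * Real.exp (-Λ) := by linarith
    have h7 : Real.exp Λ * (sSup S - χ x) < Real.exp Λ * (sSup S * Real.exp (-Λ)) :=
      mul_lt_mul_of_pos_left h6 (Real.exp_pos _)
    have h8 : Real.exp Λ * (sSup S * Real.exp (-Λ)) = sSup S := by
      rw [mul_left_comm, h5, mul_one]
    linarith

/-- Inversion of the half-plane corresponds to `w ↦ -w` on the slit plane. It transports the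
construction at the right end of `I` to the left end. -/
theorem halfPlaneGreen_inv {e ξ : ℝ} (he : 0 < e) (hξ : 0 < ξ) :
    halfPlaneGreen e⁻¹ (ξ⁻¹ : ℝ) = halfPlaneGreen e ξ := by
  simp only [halfPlaneGreen, ← Complex.ofReal_add, ← Complex.ofReal_sub, ← Complex.ofReal_div,
    Complex.norm_real, Real.norm_eq_abs, Real.log_abs]
  have h1 : (ξ⁻¹ + e⁻¹) / (ξ⁻¹ - e⁻¹) = -((ξ + e) / (ξ - e)) := by
    have h2 : ξ⁻¹ + e⁻¹ = (ξ + e) / (ξ * e) := by field_simp; ring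
    have h3 : ξ⁻¹ - e⁻¹ = -((ξ - e) / (ξ * e)) := by field_simp; ring
    rw [h2, h3, div_neg, div_div_div_cancel_right₀ (by positivity)]
  rw [h1, Real.log_neg_eq_log]

/-- The poles of the barrier can be placed at the ends of an open interval containing `[-r, r]`. -/
theorem exists_slitBarrier {r : ℝ} (hr : 0 < r) {I : Set ℝ} (hI : IsOpen I)
    (hI₁ : ∃ x ∈ I, r < x) (hI₀ : ∃ x ∈ I, x < -r) :
    ∃ a b : ℝ, 0 < a ∧ 0 < b ∧
      (∀ w : ℂ, w ∉ Complex.ofReal '' Icc (-r) r → (w.im = 0 → w.re ∈ I) →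
        ∀ e ∈ ({a, b} : Set ℝ), slitSqrt r w ≠ e) ∧
      ∀ Λ : ℝ, ∃ x₀ ∈ I, ∃ x₁ ∈ I, ∀ x ∈ I, slitBarrier r a b x ≤ Λ → x ∈ Icc x₀ x₁ := by
  obtain ⟨b, hb, hb1, hbI, hbΛ⟩ := exists_pole hr hI hI₁
  obtain ⟨a', ha', ha1', haI', haΛ'⟩ := exists_pole hr (I := -I) hI.neg (by
    obtain ⟨x, hx, hxr⟩ := hI₀
    exact ⟨-x, by simpa using hx, by linarith⟩)
  have hχneg : ∀ x : ℝ, (x - r) / (x + r) = ((-x - r) / (-x + r))⁻¹ := fun x => by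
    rw [inv_div, ← neg_div_neg_eq]
    congr 1 <;> ring
  have hup : ∀ x ∈ I, r < x → 0 < √((x - r) / (x + r)) ∧ √((x - r) / (x + r)) < b := fun x hx hrx =>
    ⟨Real.sqrt_pos.2 (div_pos (by linarith) (by linarith)), hbI x hx hrx⟩
  have hlow : ∀ x ∈ I, x < -r → 0 < √((-x - r) / (-x + r)) ∧ √((-x - r) / (-x + r)) < a' :=
    fun x hx hrx => ⟨Real.sqrt_pos.2 (div_pos (by linarith) (by linarith)),
      haI' (-x) (by simpa using hx) (by linarith)⟩
  have hs_up : ∀ x : ℝ, r < x → slitSqrt r x = (√((x - r) / (x + r)) : ℝ) := fun x hrx =>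
    slitSqrt_ofReal r (div_nonneg (by linarith) (by linarith))
  have hs_low : ∀ x : ℝ, x < -r → slitSqrt r x = ((√((-x - r) / (-x + r)))⁻¹ : ℝ) := fun x hrx => by
    have h := slitSqrt_ofReal r (x := x) (by
      rw [hχneg]; exact inv_nonneg.2 (div_nonneg (by linarith) (by linarith)))
    rw [h, hχneg, Real.sqrt_inv]
  have hsplit : ∀ w : ℂ, w ∉ Complex.ofReal '' Icc (-r) r → w.im = 0 →
      (w = (w.re : ℂ)) ∧ (r < w.re ∨ w.re < -r) := fun w hw him => by
    have h1 : w = (w.re : ℂ) := Complex.ext (by simp) (by simpa using him)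
    refine ⟨h1, ?_⟩
    by_contra! hcon
    exact hw ⟨w.re, ⟨hcon.2, hcon.1⟩, h1.symm⟩
  -- Since `b ≤ 1 ≤ a'⁻¹`, while points right of the slit have root below `b` and points left of it
  -- have root above `a'⁻¹`, neither side meets either pole.
  refine ⟨a'⁻¹, b, inv_pos.2 ha', hb, ?_, fun Λ => ?_⟩
  · intro w hw hwI e he heq
    have him := im_eq_zero_of_slitSqrt_eq hr hw heq
    obtain ⟨h1, h2⟩ := hsplit w hw him
    have hmem := hwI him
    rw [h1] at heq
    have ha1 : 1 ≤ a'⁻¹ := (one_le_inv₀ ha').2 ha1'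
    rcases h2 with h2 | h2
    · rw [hs_up _ h2, Complex.ofReal_inj] at heq
      have h3 := (hup _ hmem h2).2
      rcases he with rfl | rfl
      · linarith
      · linarith
    · rw [hs_low _ h2, Complex.ofReal_inj] at heq
      obtain ⟨h3, h4⟩ := hlow _ hmem h2
      have h5 : a'⁻¹ < (√((-w.re - r) / (-w.re + r)))⁻¹ := inv_strictAnti₀ h3 h4
      rcases he with rfl | rfl
      · linarith
      · linarith
  · obtain ⟨x₁, hx₁, hr₁, hx₁'⟩ := hbΛ Λ
    obtain ⟨x₀, hx₀, hr₀, hx₀'⟩ := haΛ' Λ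
    refine ⟨-x₀, hx₀, x₁, hx₁, fun x hx hΛ => ?_⟩
    by_cases hseg : (x : ℂ) ∈ Complex.ofReal '' Icc (-r) r
    · obtain ⟨y, hy, hyx⟩ := hseg
      rw [Complex.ofReal_inj] at hyx
      subst hyx
      exact ⟨by linarith [hy.1], by linarith [hy.2]⟩
    · have hg1 := halfPlaneGreen_nonneg (inv_pos.2 ha') (slitSqrt_re_nonneg r x)
      have hg2 := halfPlaneGreen_nonneg hb (slitSqrt_re_nonneg r x)
      rw [slitBarrier, if_neg hseg] at hΛ
      obtain ⟨-, h2⟩ := hsplit x hseg (by simp)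
      simp only [Complex.ofReal_re] at h2
      rcases h2 with h2 | h2
      · refine ⟨by linarith, hx₁' x hx h2 ?_⟩
        rw [← hs_up x h2]
        linarith
      · refine ⟨?_, by linarith⟩
        have h3 := hx₀' (-x) (by simpa using hx) (by linarith) (by
          rw [← halfPlaneGreen_inv ha' (hlow x hx h2).1, ← hs_low x h2]
          linarith)
        linarith

/-! ### Surfaces with boundary and holomorphic charts -/

section Boundary

variable {R : Type*} [TopologicalSpace R]

theorem IsSurfaceWithBoundary.diff_eq {M B : Set R} (hM : IsSurfaceWithBoundary M B) :
    M \ B = interior M \ B := by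
  ext p
  refine ⟨fun h => ⟨?_, h.2⟩, fun h => ⟨interior_subset h.1, h.2⟩⟩
  by_contra hn
  exact h.2 (hM.frontier_subset ⟨subset_closure h.1, hn⟩)

theorem IsSurfaceWithBoundary.isOpen_diff {M B : Set R} (hM : IsSurfaceWithBoundary M B) :
    IsOpen (M \ B) := by
  rw [hM.diff_eq]
  exact isOpen_interior.sdiff hM.isClosed_boundary

theorem IsSurfaceWithBoundary.eventually_punctured {M B : Set R} (hM : IsSurfaceWithBoundary M B)
    {p : R} (hp : p ∈ interior M) : ∀ᶠ q in 𝓝[≠] p, q ∈ M \ B := by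
  by_cases hpB : p ∈ B
  · obtain ⟨U, hU, hUB⟩ := hM.isolated p ⟨hpB, fun h => h.2 hp⟩
    filter_upwards [nhdsWithin_le_nhds hU, nhdsWithin_le_nhds (isOpen_interior.mem_nhds hp),
      self_mem_nhdsWithin] with q hqU hqM hq
    refine ⟨interior_subset hqM, fun hqB => hq ?_⟩
    have : q ∈ U ∩ B := ⟨hqU, hqB⟩
    rw [hUB] at this
    exact this
  · exact nhdsWithin_le_nhds (hM.isOpen_diff.mem_nhds ⟨interior_subset hp, hpB⟩)

theorem tendsto_symm_punctured {e : OpenPartialHomeomorph R ℂ} {p : R} (hp : p ∈ e.source) :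
    Tendsto e.symm (𝓝[≠] (e p)) (𝓝[≠] p) := by
  refine tendsto_nhdsWithin_iff.2 ⟨(e.tendsto_symm hp).mono_left nhdsWithin_le_nhds, ?_⟩
  filter_upwards [self_mem_nhdsWithin, nhdsWithin_le_nhds (e.open_target.mem_nhds (e.map_source hp))]
    with x hx hxt h
  exact hx (by rw [← e.right_inv hxt, h]; rfl)

end Boundary

theorem continuousAt_laplacian {F : ℂ → E3} {x : ℂ} (hF : ContDiffAt ℝ ∞ F x) :
    ContinuousAt (Δ F) x := by
  have h : ∀ v : ℂ, ContinuousAt (fun ζ => fderiv ℝ (fderiv ℝ F) ζ v v) x := fun v => by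
    have h1 : ContDiffAt ℝ 2 F x := hF.of_le ENat.LEInfty.out
    have h2 : ContinuousAt (fderiv ℝ (fderiv ℝ F)) x :=
      ((h1.fderiv_right (m := 1) (by norm_num)).fderiv_right (m := 0) (by norm_num)).continuousAt
    exact (h2.clm_apply continuousAt_const).clm_apply continuousAt_const
  have := (h 1).add (h Complex.I)
  refine this.congr (Eventually.of_forall fun ζ => ?_)
  rw [laplacian_eq_iteratedFDeriv_complexPlane]
  simp [iteratedFDeriv_two_apply]

section Charts

variable {R : Type*} [TopologicalSpace R] [ChartedSpace ℂ R]

theorem contDiffOn_transition [IsManifold 𝓘(ℂ) ω R] {e e' : OpenPartialHomeomorph R ℂ}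
    (he : e ∈ atlas ℂ R) (he' : e' ∈ atlas ℂ R) :
    ContDiffOn ℂ ω (e' ∘ e.symm) (e.symm.trans e').source := by
  have h := HasGroupoid.compatible (G := contDiffGroupoid ω 𝓘(ℂ)) he he'
  have h1 := (mem_groupoid_of_pregroupoid.1 h).1
  simpa [contDiffPregroupoid] using h1

theorem analyticAt_transition [IsManifold 𝓘(ℂ) ω R] {e e' : OpenPartialHomeomorph R ℂ}
    (he : e ∈ atlas ℂ R) (he' : e' ∈ atlas ℂ R) {p : R} (hp : p ∈ e.source)
    (hp' : p ∈ e'.source) : AnalyticAt ℂ (e' ∘ e.symm) (e p) := by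
  have hmem : e p ∈ (e.symm.trans e').source := by
    simp [hp, hp']
  exact ((contDiffOn_transition he he').contDiffAt
    ((e.symm.trans e').open_source.mem_nhds hmem)).analyticAt

instance isManifold_real [IsManifold 𝓘(ℂ) ω R] : IsManifold 𝓘(ℝ, ℂ) ∞ R := by
  refine isManifold_of_contDiffOn 𝓘(ℝ, ℂ) ∞ R fun e e' he he' => ?_
  have h := (contDiffOn_transition he he').restrict_scalars ℝ
  simpa using h.of_le le_top

theorem contDiffOn_comp_symm [IsManifold 𝓘(ℂ) ω R] {Y : R → E3}
    (hY : ContMDiff 𝓘(ℝ, ℂ) 𝓘(ℝ, E3) ∞ Y) {e : OpenPartialHomeomorph R ℂ}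
    (he : e ∈ atlas ℂ R) : ContDiffOn ℝ ∞ (Y ∘ e.symm) e.target := by
  have h1 := contMDiffOn_symm_of_mem_maximalAtlas (I := 𝓘(ℝ, ℂ)) (n := ∞)
    (IsManifold.subset_maximalAtlas he)
  exact (hY.comp_contMDiffOn h1).contDiffOn

theorem contDiffAt_comp_symm [IsManifold 𝓘(ℂ) ω R] {Y : R → E3}
    (hY : ContMDiff 𝓘(ℝ, ℂ) 𝓘(ℝ, E3) ∞ Y) {e : OpenPartialHomeomorph R ℂ}
    (he : e ∈ atlas ℂ R) {x : ℂ} (hx : x ∈ e.target) : ContDiffAt ℝ ∞ (Y ∘ e.symm) x :=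
  (contDiffOn_comp_symm hY he).contDiffAt (e.open_target.mem_nhds hx)

/-- At an isolated boundary point inside `M` the identities follow by continuity from a punctured
neighbourhood. The immersion property need not survive this limit, hence the weak form of
conformality. -/
theorem IsConformalMinimalImmersion.laplacian_eq_zero [IsManifold 𝓘(ℂ) ω R] {Y : R → E3}
    {M B : Set R} (hM : IsSurfaceWithBoundary M B) (hY : IsConformalMinimalImmersion Y M B)
    {e : OpenPartialHomeomorph R ℂ} (he : e ∈ atlas ℂ R) {p : R} (hp : p ∈ e.source)
    (hpM : p ∈ interior M) :
    Δ (Y ∘ e.symm) (e p) = 0 ∧ IsWeaklyConformalAt (Y ∘ e.symm) (e p) := by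
  set F := Y ∘ e.symm with hF
  have hsm : ∀ x ∈ e.target, ContDiffAt ℝ ∞ F x := fun x hx => contDiffAt_comp_symm hY.smooth he hx
  have hc : ∀ x ∈ e.target, e.symm x ∈ M \ B → ConformalAt F x := fun x hx hxM => by
    simpa [e.right_inv hx] using hY.conformal _ hxM e he (e.map_target hx)
  have hloc : ∀ x ∈ e.target, e.symm x ∈ M \ B → Δ F x = 0 ∧ IsWeaklyConformalAt F x := by
    intro x hx hxM
    refine ⟨laplacian_eq_zero_of_meanCurvature_eq_zero
      ((hsm x hx).of_le ENat.LEInfty.out) ?_ ?_,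
      isWeaklyConformalAt_of_conformalAt (hc x hx hxM)⟩
    · filter_upwards [e.open_target.mem_nhds hx,
        (e.continuousAt_symm hx).preimage_mem_nhds (hM.isOpen_diff.mem_nhds hxM)] with y hy hyM
      exact hc y hy hyM
    · simpa [e.right_inv hx] using hY.minimal _ hxM e he (e.map_target hx)
  have hev : ∀ᶠ x in 𝓝[≠] (e p), Δ F x = 0 ∧ IsWeaklyConformalAt F x := by
    filter_upwards [(tendsto_symm_punctured hp).eventually (hM.eventually_punctured hpM),
      nhdsWithin_le_nhds (e.open_target.mem_nhds (e.map_source hp))] with x hx hxt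
    exact hloc x hxt hx
  have hFp := hsm _ (e.map_source hp)
  have h1 : ContinuousAt (fderiv ℝ F) (e p) :=
    ((hFp.of_le (m := 1) ENat.LEInfty.out).fderiv_right (m := 0)
      (by norm_num)).continuousAt
  have hdu : ContinuousAt (du F) (e p) := h1.clm_apply continuousAt_const
  have hdv : ContinuousAt (dv F) (e p) := h1.clm_apply continuousAt_const
  have huniq : ∀ {X : Type} [TopologicalSpace X] [T2Space X] (a b : ℂ → X),
      ContinuousAt a (e p) → ContinuousAt b (e p) → (∀ᶠ x in 𝓝[≠] (e p), a x = b x) →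
      a (e p) = b (e p) := fun a b ha hb h =>
    tendsto_nhds_unique ((ha.mono_left nhdsWithin_le_nhds).congr' h)
      (hb.mono_left nhdsWithin_le_nhds)
  exact ⟨huniq (Δ F) (fun _ => 0) (continuousAt_laplacian hFp) continuousAt_const
      (hev.mono fun x h => h.1),
    huniq _ _ (hdu.inner hdu) (hdv.inner hdv) (hev.mono fun x h => h.2.1),
    huniq _ _ (hdu.inner hdv) continuousAt_const (hev.mono fun x h => h.2.2)⟩

/-- The coordinates of a minimal immersion are harmonic in the interior. -/
theorem IsConformalMinimalImmersion.harmonicAt_comp [IsManifold 𝓘(ℂ) ω R] {Y : R → E3}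
    {M B : Set R} (hM : IsSurfaceWithBoundary M B) (hY : IsConformalMinimalImmersion Y M B)
    {e : OpenPartialHomeomorph R ℂ} (he : e ∈ atlas ℂ R) {p : R} (hp : p ∈ e.source)
    (hpM : p ∈ interior M) (l : E3 →L[ℝ] ℝ) :
    HarmonicAt (fun ζ => l (Y (e.symm ζ))) (e p) := by
  have hF : HarmonicAt (Y ∘ e.symm) (e p) := by
    refine ⟨(contDiffAt_comp_symm hY.smooth he (e.map_source hp)).of_le
      ENat.LEInfty.out, ?_⟩
    filter_upwards [e.open_target.mem_nhds (e.map_source hp),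
      (e.continuousAt_symm (e.map_source hp)).preimage_mem_nhds
        (isOpen_interior.mem_nhds (by simpa [e.left_inv hp] using hpM))] with x hx hxM
    simpa [e.right_inv hx] using (hY.laplacian_eq_zero hM he (e.map_target hx) hxM).1
  exact hF.comp_CLM (l := l)

end Charts

/-! ### The inverse of the projection of a graph -/

/-- The projection `proj` as a continuous linear map. -/
noncomputable def projCLM : E3 →L[ℝ] ℂ :=
  Complex.ofRealCLM ∘L EuclideanSpace.proj 0 +
    (Complex.I • Complex.ofRealCLM) ∘L EuclideanSpace.proj 1

theorem projCLM_apply (x : E3) : projCLM x = proj x := by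
  apply Complex.ext <;> simp [projCLM, proj]

/-- `φ` is the inverse of the bijection `proj ∘ Y` of `M` onto `Ω`. -/
structure IsGraphLift {R : Type*} [TopologicalSpace R] (Y : R → E3) (M : Set R) (Ω : Set ℂ)
    (φ : ℂ → R) : Prop where
  continuousOn : ContinuousOn φ Ω
  mapsTo : ∀ w ∈ Ω, φ w ∈ M
  proj_apply : ∀ w ∈ Ω, proj (Y (φ w)) = w
  proj_mem : ∀ p ∈ M, proj (Y p) ∈ Ω
  apply_proj : ∀ p ∈ M, φ (proj (Y p)) = p

section Topological

variable {R : Type*} [TopologicalSpace R] {Y : R → E3} {M : Set R} {Ω : Set ℂ} {φ : ℂ → R}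

/-- Properness and injectivity make `Y` a closed embedding of `M`. Its inverse on the graph,
composed with `w ↦ (w, u w)`, is therefore continuous. -/
theorem exists_isGraphLift [Nonempty R] (hproper : IsProperMap (M.domRestrict Y))
    (hgraph : IsGraphOver Y M Ω) : ∃ φ : ℂ → R, IsGraphLift Y M Ω φ := by
  obtain ⟨hinj, u, hu, himg⟩ := hgraph
  set s : ℂ → E3 := fun w => WithLp.toLp 2 ![w.re, w.im, u w] with hs
  have hsp : ∀ w, proj (s w) = w := fun w => by apply Complex.ext <;> simp [hs, proj]
  have hex : ∀ w ∈ Ω, ∃ p ∈ M, Y p = s w := fun w hw => by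
    have : s w ∈ Y '' M := by
      rw [himg]
      refine ⟨by rwa [hsp], ?_⟩
      rw [hsp]
      simp [hs]
    exact this
  have hmem : ∀ p ∈ M, proj (Y p) ∈ Ω ∧ Y p = s (proj (Y p)) := fun p hp => by
    have : Y p ∈ Y '' M := ⟨p, hp, rfl⟩
    rw [himg] at this
    refine ⟨this.1, ?_⟩
    ext i
    fin_cases i
    · simp [hs, proj]
    · simp [hs, proj]
    · simpa [hs] using this.2
  choose! φ hφM hφ using hex
  refine ⟨φ, ?_, hφM, fun w hw => by rw [hφ w hw, hsp], fun p hp => (hmem p hp).1, fun p hp =>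
    hinj (hφM _ (hmem p hp).1) hp ((hφ _ (hmem p hp).1).trans (hmem p hp).2.symm)⟩
  have hemb : Topology.IsClosedEmbedding (M.domRestrict Y) :=
    .of_continuous_injective_isClosedMap hproper.continuous
      (injOn_iff_injective.1 hinj) hproper.isClosedMap
  have hscont : ContinuousOn s Ω := by
    refine (PiLp.continuous_toLp 2 _).comp_continuousOn (continuousOn_pi.2 fun i => ?_)
    fin_cases i
    · exact Complex.continuous_re.continuousOn
    · exact Complex.continuous_im.continuousOn
    · exact hu
  rw [continuousOn_iff_continuous_domRestrict] at hscont ⊢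
  have h2 : Continuous (fun w : Ω => (⟨φ w, hφM w w.2⟩ : M)) := by
    rw [hemb.isInducing.continuous_iff]
    refine hscont.congr fun w => ?_
    exact (hφ w w.2).symm
  exact continuous_subtype_val.comp h2

theorem isCompact_norm_le (hproper : IsProperMap (M.domRestrict Y)) (C : ℝ) :
    IsCompact {p ∈ M | ‖Y p‖ ≤ C} := by
  have h := (hproper.isCompact_preimage (isCompact_closedBall (0 : E3) C)).image
    continuous_subtype_val
  convert h using 1
  ext p
  simp [and_comm]

theorem IsGraphLift.injOn (hφ : IsGraphLift Y M Ω φ) : InjOn (fun p => proj (Y p)) M :=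
  fun p hp q hq h => by rw [← hφ.apply_proj p hp, ← hφ.apply_proj q hq]; exact congrArg φ h

/-- A point of `M` that lies over an interior point of `Ω` is an interior point of `M`. -/
theorem IsGraphLift.mem_interior_of_proj_mem [ChartedSpace ℂ R] [IsManifold 𝓘(ℂ) ω R]
    (hφ : IsGraphLift Y M Ω φ) (hY : ContMDiff 𝓘(ℝ, ℂ) 𝓘(ℝ, E3) ∞ Y) {p : R} (hp : p ∈ M)
    (hpΩ : proj (Y p) ∈ interior Ω) : p ∈ interior M := by
  set e := chartAt ℂ p with he
  set w₀ := proj (Y p) with hw₀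
  have hφw : φ w₀ = p := hφ.apply_proj p hp
  have hcont : ContinuousAt φ w₀ := hφ.continuousOn.continuousAt (mem_interior_iff_mem_nhds.1 hpΩ)
  have hps : p ∈ e.source := mem_chart_source ℂ p
  have hev : ∀ᶠ w in 𝓝 w₀, w ∈ Ω ∧ φ w ∈ e.source :=
    Filter.Eventually.and (mem_interior_iff_mem_nhds.1 hpΩ)
      (hcont.eventually_mem (by rw [hφw]; exact e.open_source.mem_nhds hps))
  obtain ⟨ρ, hρ, hball⟩ := Metric.nhds_basis_closedBall.eventually_iff.1 hev
  have hc : ContinuousOn (e ∘ φ) (Metric.closedBall w₀ ρ) :=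
    e.continuousOn.comp (hφ.continuousOn.mono fun w hw => (hball hw).1) fun w hw => (hball hw).2
  -- `Y` is smooth on the ambient surface, so this left inverse of `e ∘ φ` is differentiable on the
  -- whole chart, also outside `M`.
  have hq : DifferentiableOn ℝ (fun ζ => projCLM (Y (e.symm ζ))) e.target :=
    projCLM.differentiable.comp_differentiableOn
      ((contDiffOn_comp_symm hY (chart_mem_atlas ℂ p)).differentiableOn (by simp))
  have h := image_closedBall_mem_nhds hρ hc e.open_target
    (fun w hw => e.map_source (hball hw).2) hq (fun w hw => by
      simp only [Function.comp, e.left_inv (hball hw).2, projCLM_apply]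
      exact hφ.proj_apply w (hball hw).1)
  simp only [Function.comp, hφw] at h
  rw [mem_interior_iff_mem_nhds]
  filter_upwards [e.open_source.mem_nhds hps, (e.continuousAt hps).preimage_mem_nhds h] with x hx hx'
  obtain ⟨w, hw, hwx⟩ := hx'
  have : φ w = x := e.injOn (hball hw).2 hx hwx
  exact this ▸ hφ.mapsTo w (hball hw).1

theorem symm_mem_interior_nhds {e : OpenPartialHomeomorph R ℂ} {p : R} (hp : p ∈ e.source)
    (hpM : p ∈ interior M) : ∀ᶠ ζ in 𝓝 (e p), ζ ∈ e.target ∧ e.symm ζ ∈ interior M :=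
  Filter.Eventually.and (e.open_target.mem_nhds (e.map_source hp))
    ((e.tendsto_symm hp).eventually (isOpen_interior.mem_nhds hpM))

end Topological

/-! ### The projection is a local diffeomorphism -/

section Lewy

variable {R : Type*} [TopologicalSpace R] [ChartedSpace ℂ R] [IsManifold 𝓘(ℂ) ω R]
  {Y : R → E3} {M B : Set R} {Ω : Set ℂ} {φ : ℂ → R}

/-- For `l ≠ 0` the numbers `l w` and `l (i w)` determine `w`, so the two forms are jointly
injective on `M` and `fderiv_ne_zero_of_injOn` applies. This includes isolated boundary points,
where `Y` is not assumed to be an immersion. -/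
theorem IsGraphLift.fderiv_comp_ne_zero (hφ : IsGraphLift Y M Ω φ)
    (hM : IsSurfaceWithBoundary M B) (hY : IsConformalMinimalImmersion Y M B)
    {e : OpenPartialHomeomorph R ℂ} (he : e ∈ atlas ℂ R) {p : R} (hp : p ∈ e.source)
    (hpM : p ∈ interior M) {l : ℂ →L[ℝ] ℝ} (hl : l ≠ 0) :
    fderiv ℝ (fun ζ => l (projCLM (Y (e.symm ζ)))) (e p) ≠ 0 := by
  have hU := symm_mem_interior_nhds hp hpM
  refine fderiv_ne_zero_of_injOn (b := fun ζ => l (Complex.I * projCLM (Y (e.symm ζ))))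
    (hY.harmonicAt_comp hM he hp hpM (l ∘L projCLM)) hU ?_ ?_
  · have h1 := (contDiffOn_comp_symm hY.smooth he).continuousOn
    have h2 : Continuous (fun x : E3 => l (Complex.I * projCLM x)) := by fun_prop
    exact h2.comp_continuousOn (h1.mono fun ζ hζ => hζ.1)
  · intro ζ hζ ξ hξ h
    simp only [Prod.mk.injEq] at h
    set w := projCLM (Y (e.symm ζ)) - projCLM (Y (e.symm ξ)) with hw
    have h1 : l w = 0 := by rw [hw, map_sub, h.1, sub_self]
    have h2 : l (Complex.I * w) = 0 := by rw [hw, mul_sub, map_sub, h.2, sub_self]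
    have hw0 : w = 0 := by
      by_contra hne
      refine hl (ContinuousLinearMap.ext fun v => ?_)
      have hv : v = (v / w).re • w + (v / w).im • (Complex.I * w) := by
        have : v = (v / w) * w := by field_simp
        conv_lhs => rw [this, ← Complex.re_add_im (v / w)]
        simp only [Complex.real_smul]
        ring
      rw [hv, map_add, map_smul, map_smul, h1, h2]
      simp
    have h3 := hφ.injOn (interior_subset hζ.2) (interior_subset hξ.2)
      (by simpa [projCLM_apply] using sub_eq_zero.1 hw0)
    exact e.symm.injOn hζ.1 hξ.1 h3

/-- The projection of a minimal graph is a local diffeomorphism in the interior. -/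
theorem IsGraphLift.exists_hasFDerivAt_equiv (hφ : IsGraphLift Y M Ω φ)
    (hM : IsSurfaceWithBoundary M B) (hY : IsConformalMinimalImmersion Y M B)
    {e : OpenPartialHomeomorph R ℂ} (he : e ∈ atlas ℂ R) {p : R} (hp : p ∈ e.source)
    (hpM : p ∈ interior M) : ∃ L : ℂ ≃L[ℝ] ℂ,
      HasFDerivAt (fun ζ => projCLM (Y (e.symm ζ))) (L : ℂ →L[ℝ] ℂ) (e p) := by
  have hd : DifferentiableAt ℝ (fun ζ => projCLM (Y (e.symm ζ))) (e p) :=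
    projCLM.differentiableAt.comp (e p)
      ((contDiffAt_comp_symm hY.smooth he (e.map_source hp)).differentiableAt (by simp))
  set D := fderiv ℝ (fun ζ => projCLM (Y (e.symm ζ))) (e p) with hD
  have hsurj : Function.Surjective D := by
    rw [← ContinuousLinearMap.coe_coe, ← LinearMap.range_eq_top]
    by_contra hne
    -- A proper range would be killed by a nonzero functional, which would then have a critical
    -- point.
    obtain ⟨f, hf, hle⟩ := Submodule.exists_le_ker_of_lt_top _ (lt_top_iff_ne_top.2 hne)
    set l : ℂ →L[ℝ] ℝ := LinearMap.toContinuousLinearMap f with hl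
    have hl0 : l ≠ 0 := fun h => hf (by ext x; simpa [hl] using DFunLike.congr_fun h _)
    refine hφ.fderiv_comp_ne_zero hM hY he hp hpM hl0 ?_
    have : HasFDerivAt (fun ζ => l (projCLM (Y (e.symm ζ)))) (l ∘L D) (e p) :=
      l.hasFDerivAt.comp (e p) hd.hasFDerivAt
    rw [this.fderiv]
    ext v
    · exact hle ⟨_, rfl⟩
  have hinj : Function.Injective D := by
    rw [← ContinuousLinearMap.coe_coe]
    exact LinearMap.injective_iff_surjective.2 hsurj
  refine ⟨(LinearEquiv.ofBijective (D : ℂ →ₗ[ℝ] ℂ) ⟨hinj, hsurj⟩).toContinuousLinearEquiv, ?_⟩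
  exact hd.hasFDerivAt

theorem contDiffAt_proj_comp_symm (hY : ContMDiff 𝓘(ℝ, ℂ) 𝓘(ℝ, E3) ∞ Y)
    {e : OpenPartialHomeomorph R ℂ} (he : e ∈ atlas ℂ R) {p : R} (hp : p ∈ e.source) :
    ContDiffAt ℝ ∞ (fun ζ => projCLM (Y (e.symm ζ))) (e p) :=
  projCLM.contDiff.contDiffAt.comp (e p) (contDiffAt_comp_symm hY he (e.map_source hp))

theorem IsGraphLift.proj_mem_interior (hφ : IsGraphLift Y M Ω φ)
    (hM : IsSurfaceWithBoundary M B) (hY : IsConformalMinimalImmersion Y M B)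
    {p : R} (hpM : p ∈ interior M) : proj (Y p) ∈ interior Ω := by
  have hp := mem_chart_source ℂ p
  obtain ⟨L, hL⟩ := hφ.exists_hasFDerivAt_equiv hM hY (chart_mem_atlas ℂ p) hp hpM
  have hst := ((contDiffAt_proj_comp_symm hY.smooth (chart_mem_atlas ℂ p) hp).hasStrictFDerivAt'
    hL (by simp)).map_nhds_eq_of_equiv
  rw [mem_interior_iff_mem_nhds]
  have h1 := symm_mem_interior_nhds hp hpM
  have h2 : Ω ∈ map (fun ζ => projCLM (Y ((chartAt ℂ p).symm ζ))) (𝓝 (chartAt ℂ p p)) :=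
    h1.mono fun ζ hζ => by
      simpa [projCLM_apply] using hφ.proj_mem _ (interior_subset hζ.2)
  rw [hst] at h2
  simpa [projCLM_apply, (chartAt ℂ p).left_inv hp] using h2

/-- In a chart, the inverse of the projection is smooth over interior points. -/
theorem IsGraphLift.contDiffAt_chart_comp (hφ : IsGraphLift Y M Ω φ)
    (hM : IsSurfaceWithBoundary M B) (hY : IsConformalMinimalImmersion Y M B)
    {e : OpenPartialHomeomorph R ℂ} (he : e ∈ atlas ℂ R) {p : R} (hp : p ∈ e.source)
    (hpM : p ∈ interior M) : ContDiffAt ℝ ∞ (e ∘ φ) (proj (Y p)) := by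
  obtain ⟨L, hL⟩ := hφ.exists_hasFDerivAt_equiv hM hY he hp hpM
  have hcd := contDiffAt_proj_comp_symm hY.smooth he hp
  have hst := hcd.hasStrictFDerivAt' hL (by simp)
  set X : ℂ → ℂ := fun ζ => projCLM (Y (e.symm ζ)) with hX
  set g := hcd.localInverse hL (by simp) with hg
  have hXp : X (e p) = proj (Y p) := by simp [hX, projCLM_apply, e.left_inv hp]
  have hgc : ContDiffAt ℝ ∞ g (X (e p)) := hcd.to_localInverse hL (by simp)
  have hgp : g (X (e p)) = e p := hcd.localInverse_apply_image hL (by simp)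
  have hright : ∀ᶠ w in 𝓝 (X (e p)), X (g w) = w := hst.eventually_right_inverse
  rw [hXp] at hgc hgp hright
  refine hgc.congr_of_eventuallyEq ?_
  have h1 := hgc.continuousAt.eventually (by rw [hgp]; exact symm_mem_interior_nhds hp hpM)
  filter_upwards [hright, h1] with w hw hw1
  have h2 : φ w = e.symm (g w) := by
    rw [← hφ.apply_proj _ (interior_subset hw1.2), ← projCLM_apply]
    exact congrArg φ hw.symm
  simp [h2, e.right_inv hw1.1]

end Lewy

/-! ### The harmonic conjugate of the second coordinate -/

theorem starConvex_interior {z₀ : ℂ} {Ω : Set ℂ} (hz₀ : z₀ ∈ interior Ω)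
    (hstar : StarConvex ℝ z₀ Ω) : StarConvex ℝ z₀ (interior Ω) := by
  intro w hw a b ha hb hab
  rcases hb.eq_or_lt with rfl | hb
  · have : a = 1 := by linarith
    simpa [this] using hz₀
  · have hopen : IsOpen ((fun x : ℂ => a • z₀ + b • x) '' interior Ω) :=
      ((Homeomorph.smulOfNeZero b hb.ne').trans (Homeomorph.addLeft (a • z₀))).isOpenMap _
        isOpen_interior
    refine interior_maximal ?_ hopen ⟨w, hw, rfl⟩
    rintro _ ⟨x, hx, rfl⟩
    exact hstar (interior_subset hx) ha hb.le hab

theorem hasFDerivAt_of_re_im {f : ℂ → ℂ} {A : ℂ →L[ℝ] ℂ} {x : ℂ}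
    (hre : HasFDerivAt (fun ζ => (f ζ).re) (Complex.reCLM ∘L A) x)
    (him : HasFDerivAt (fun ζ => (f ζ).im) (Complex.imCLM ∘L A) x) : HasFDerivAt f A x := by
  have h1 := (Complex.ofRealCLM.hasFDerivAt (x := (f x).re)).comp x hre
  have h2 := (Complex.ofRealCLM.hasFDerivAt (x := (f x).im)).comp x him
  have h3 := h1.add (h2.const_mul Complex.I)
  refine (h3.congr_fderiv ?_).congr_of_eventuallyEq (Eventually.of_forall fun ζ => ?_)
  · refine ContinuousLinearMap.ext fun v => ?_
    apply Complex.ext <;> simp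
  · apply Complex.ext <;> simp

/-- Holomorphic functions with the same imaginary part have the same derivative. -/
theorem fderiv_eq_of_im_eq {f g : ℂ → ℂ} {x : ℂ} (hf : AnalyticAt ℂ f x)
    (hg : AnalyticAt ℂ g x) (him : ∀ᶠ ζ in 𝓝 x, (f ζ).im = (g ζ).im) :
    fderiv ℝ f x = fderiv ℝ g x := by
  have hd := (hf.sub hg).differentiableAt.hasDerivAt
  set d := deriv (f - g) x
  have hR := hd.hasFDerivAt.restrictScalars ℝ
  have h1 := (Complex.imCLM.hasFDerivAt (x := (f - g) x)).comp x hR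
  have h2 : HasFDerivAt (fun ζ => ((f - g) ζ).im) (0 : ℂ →L[ℝ] ℝ) x :=
    (hasFDerivAt_const (0 : ℝ) x).congr_of_eventuallyEq (him.mono fun ζ h => by simp [h])
  have h3 := h1.unique h2
  have e1 := DFunLike.congr_fun h3 1
  have e2 := DFunLike.congr_fun h3 Complex.I
  simp at e1 e2
  have hd0 : d = 0 := Complex.ext e2 e1
  have h4 := hR.fderiv
  rw [fderiv_sub (hf.differentiableAt.restrictScalars ℝ) (hg.differentiableAt.restrictScalars ℝ)]
    at h4
  rw [← sub_eq_zero, h4, hd0]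
  ext v; simp

section Conjugate

variable {R : Type*} [TopologicalSpace R] [ChartedSpace ℂ R] [IsManifold 𝓘(ℂ) ω R]
  {Y : R → E3} {M B : Set R} {Ω : Set ℂ} {φ : ℂ → R}

/-- In a chart, the second coordinate is locally the imaginary part of a holomorphic function. -/
theorem IsConformalMinimalImmersion.exists_analyticAt_im (hM : IsSurfaceWithBoundary M B)
    (hY : IsConformalMinimalImmersion Y M B) {e : OpenPartialHomeomorph R ℂ} (he : e ∈ atlas ℂ R)
    {p : R} (hp : p ∈ e.source) (hpM : p ∈ interior M) : ∃ K : ℂ → ℂ, AnalyticAt ℂ K (e p) ∧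
      ∀ᶠ ζ in 𝓝 (e p), (K ζ).im = (projCLM (Y (e.symm ζ))).im := by
  obtain ⟨H, hH, hre⟩ := exists_analyticAt_re_eq
    (hY.harmonicAt_comp hM he hp hpM (Complex.imCLM ∘L projCLM))
  refine ⟨fun ζ => Complex.I * H ζ, analyticAt_const.mul hH, hre.mono fun ζ h => ?_⟩
  simpa using h

/-- The second coordinate of a minimal graph over a starlike domain has a global harmonic
conjugate, here written as a function on the domain. -/
theorem IsGraphLift.exists_conjugate (hφ : IsGraphLift Y M Ω φ)
    (hM : IsSurfaceWithBoundary M B) (hY : IsConformalMinimalImmersion Y M B) {z₀ : ℂ}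
    (hz₀ : z₀ ∈ interior Ω) (hstar : StarConvex ℝ z₀ Ω) : ∃ Q : ℂ → ℝ, Q z₀ = 0 ∧
      (∀ w ∈ interior Ω, DifferentiableAt ℝ Q w) ∧
      ∀ p ∈ interior M, ∀ e ∈ atlas ℂ R, p ∈ e.source →
        AnalyticAt ℂ (fun ζ => (⟨Q (proj (Y (e.symm ζ))),
          (proj (Y (e.symm ζ))).im - z₀.im⟩ : ℂ)) (e p) := by
  have hK : ∀ p : R, ∃ K : ℂ → ℂ, p ∈ interior M → AnalyticAt ℂ K (chartAt ℂ p p) ∧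
      ∀ᶠ ζ in 𝓝 (chartAt ℂ p p), (K ζ).im = (projCLM (Y ((chartAt ℂ p).symm ζ))).im := by
    intro p
    by_cases hp : p ∈ interior M
    · obtain ⟨K, hK⟩ := hY.exists_analyticAt_im hM (chart_mem_atlas ℂ p) (mem_chart_source ℂ p) hp
      exact ⟨K, fun _ => hK⟩
    · exact ⟨0, fun h => absurd h hp⟩
  choose K hKa using hK
  have hφN : ∀ w ∈ interior Ω, φ w ∈ interior M := fun w hw => by
    have hw' := interior_subset hw
    refine hφ.mem_interior_of_proj_mem hY.smooth (hφ.mapsTo w hw') ?_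
    rwa [hφ.proj_apply w hw']
  -- the local functions in a chart around `p`
  have hG : ∀ p ∈ interior M, ∀ e ∈ atlas ℂ R, p ∈ e.source →
      AnalyticAt ℂ (fun ζ => K p (chartAt ℂ p (e.symm ζ))) (e p) ∧
      ∀ᶠ ζ in 𝓝 (e p), (K p (chartAt ℂ p (e.symm ζ))).im = (projCLM (Y (e.symm ζ))).im := by
    intro p hp e he hpe
    have ht := analyticAt_transition he (chart_mem_atlas ℂ p) hpe (mem_chart_source ℂ p)
    have hval : (chartAt ℂ p ∘ e.symm) (e p) = chartAt ℂ p p := by simp [e.left_inv hpe]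
    refine ⟨AnalyticAt.fun_comp (f := chartAt ℂ p ∘ e.symm) (by rw [hval]; exact (hKa p hp).1) ht, ?_⟩
    have h1 := ht.continuousAt.eventually (by rw [hval]; exact (hKa p hp).2)
    filter_upwards [h1, (e.tendsto_symm hpe).eventually
      ((chartAt ℂ p).open_source.mem_nhds (mem_chart_source ℂ p))] with ζ h h2
    have h3 : (chartAt ℂ p).symm ((chartAt ℂ p) (e.symm ζ)) = e.symm ζ :=
      (chartAt ℂ p).left_inv h2
    simpa [h3] using h
  -- Local conjugates read on the plane domain. Two of them come from holomorphic functions with the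
  -- same imaginary part, so their differentials agree and define one closed form.
  set P : ℂ → ℂ → ℝ := fun w w' => (K (φ w) (chartAt ℂ (φ w) (φ w'))).re with hPdef
  have hlift : ∀ w ∈ interior Ω, ∀ e ∈ atlas ℂ R, φ w ∈ e.source →
      ContDiffAt ℝ ∞ (e ∘ φ) w := fun w hw e he hwe => by
    simpa [hφ.proj_apply w (interior_subset hw)] using
      hφ.contDiffAt_chart_comp hM hY he hwe (hφN w hw)
  have hP : ∀ w ∈ interior Ω, ContDiffAt ℝ 2 (P w) w := fun w hw => by
    have h1 : ContDiffAt ℝ 2 (K (φ w)) ((chartAt ℂ (φ w) ∘ φ) w) :=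
      ((hKa _ (hφN w hw)).1.contDiffAt.restrict_scalars ℝ)
    have h2 := (hlift w hw _ (chart_mem_atlas ℂ (φ w)) (mem_chart_source ℂ _)).of_le
      (m := 2) ENat.LEInfty.out
    exact Complex.reCLM.contDiff.contDiffAt.comp w (h1.comp w h2)
  have hφc : ∀ w ∈ interior Ω, ContinuousAt φ w := fun w hw =>
    hφ.continuousOn.continuousAt (mem_interior_iff_mem_nhds.1 hw)
  have hPP : ∀ w ∈ interior Ω, ∀ᶠ w' in 𝓝 w, fderiv ℝ (P w') w' = fderiv ℝ (P w) w' := by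
    intro w hw
    set e := chartAt ℂ (φ w) with he
    have hea : e ∈ atlas ℂ R := chart_mem_atlas ℂ _
    have hs : ∀ᶠ w' in 𝓝 w, φ w' ∈ e.source :=
      (hφc w hw).eventually (e.open_source.mem_nhds (mem_chart_source ℂ _))
    have h1 : ∀ᶠ w' in 𝓝 w, AnalyticAt ℂ (K (φ w)) (e (φ w')) ∧
        ∀ᶠ ζ in 𝓝 (e (φ w')), (K (φ w) ζ).im = (projCLM (Y (e.symm ζ))).im := by
      have hc : ContinuousAt (e ∘ φ) w := (hlift w hw e hea (mem_chart_source ℂ _)).continuousAt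
      exact hc.eventually ((hKa _ (hφN w hw)).1.eventually_analyticAt.and
        (hKa _ (hφN w hw)).2.eventually_nhds)
    filter_upwards [hs, h1, isOpen_interior.mem_nhds hw] with w' hs' h1' hw'
    obtain ⟨ga, gim⟩ := hG (φ w') (hφN w' hw') e hea hs'
    have heq := fderiv_eq_of_im_eq ga h1'.1 (by
      filter_upwards [gim, h1'.2] with ζ a b
      rw [a, b])
    have hd := (hlift w' hw' e hea hs').differentiableAt (by simp)
    have d1 : HasFDerivAt (fun x => (K (φ w') (chartAt ℂ (φ w') (e.symm (e (φ x))))).re)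
        (Complex.reCLM ∘L (fderiv ℝ (fun ζ => K (φ w') (chartAt ℂ (φ w') (e.symm ζ)))
          (e (φ w')) ∘L fderiv ℝ (e ∘ φ) w')) w' :=
      Complex.reCLM.hasFDerivAt.comp w'
        (HasFDerivAt.comp (f := e ∘ φ) (g := fun ζ => K (φ w') (chartAt ℂ (φ w') (e.symm ζ))) w'
          (ga.differentiableAt.restrictScalars ℝ).hasFDerivAt hd.hasFDerivAt)
    have d2 : HasFDerivAt (P w)
        (Complex.reCLM ∘L (fderiv ℝ (K (φ w)) (e (φ w')) ∘L fderiv ℝ (e ∘ φ) w')) w' :=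
      Complex.reCLM.hasFDerivAt.comp w'
        (HasFDerivAt.comp w' (h1'.1.differentiableAt.restrictScalars ℝ).hasFDerivAt hd.hasFDerivAt)
    have d3 := d1.congr_of_eventuallyEq (f₁ := P w') (by
      filter_upwards [(hφc w' hw').eventually (e.open_source.mem_nhds hs')] with x hx
      simp only [hPdef]
      rw [e.left_inv hx])
    rw [d3.fderiv, d2.fderiv, heq]
  obtain ⟨Q, hQ⟩ := exists_primitive_of_starConvex isOpen_interior hz₀
    (starConvex_interior hz₀ hstar) P hP hPP
  refine ⟨fun w => Q w - Q z₀, sub_self _, fun w hw => (hQ w hw).differentiableAt.sub_const _,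
    fun p hp e he hpe => ?_⟩
  -- At each nearby point the real differential of the function is that of the local holomorphic
  -- `K`, hence complex linear.
  rw [Complex.analyticAt_iff_eventually_differentiableAt]
  filter_upwards [symm_mem_interior_nhds hpe hp] with x hx
  obtain ⟨p', hp'e, rfl⟩ : ∃ p' ∈ e.source, e p' = x := ⟨_, e.map_target hx.1, e.right_inv hx.1⟩
  have hp' : p' ∈ interior M := by simpa [e.left_inv hp'e] using hx.2
  obtain ⟨ga, gim⟩ := hG p' hp' e he hp'e
  set w := proj (Y p') with hw
  have hwΩ : w ∈ interior Ω := hφ.proj_mem_interior hM hY hp'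
  have hφw : φ w = p' := hφ.apply_proj _ (interior_subset hp')
  have hXd := (contDiffAt_proj_comp_symm hY.smooth he hp'e).differentiableAt (by simp)
  have hXp : projCLM (Y (e.symm (e p'))) = w := by rw [e.left_inv hp'e, projCLM_apply]
  set A := fderiv ℂ (fun ζ => K p' (chartAt ℂ p' (e.symm ζ))) (e p') with hA
  have hAR : HasFDerivAt (fun ζ => K p' (chartAt ℂ p' (e.symm ζ))) (A.restrictScalars ℝ) (e p') :=
    ga.differentiableAt.hasFDerivAt.restrictScalars ℝ
  have hre : HasFDerivAt (fun ζ => Q (projCLM (Y (e.symm ζ))))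
      (Complex.reCLM ∘L A.restrictScalars ℝ) (e p') := by
    have c1 : HasFDerivAt (fun ζ => Q (projCLM (Y (e.symm ζ)))) (fderiv ℝ (P w) w ∘L
        fderiv ℝ (fun ζ => projCLM (Y (e.symm ζ))) (e p')) (e p') :=
      HasFDerivAt.comp (e p') (by rw [hXp]; exact hQ w hwΩ) hXd.hasFDerivAt
    have c2 : HasFDerivAt (fun ζ => P w (projCLM (Y (e.symm ζ)))) (fderiv ℝ (P w) w ∘L
        fderiv ℝ (fun ζ => projCLM (Y (e.symm ζ))) (e p')) (e p') :=
      HasFDerivAt.comp (g := P w) (e p') (by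
        rw [hXp]; exact ((hP w hwΩ).differentiableAt (by simp)).hasFDerivAt) hXd.hasFDerivAt
    have c3 : HasFDerivAt (fun ζ => P w (projCLM (Y (e.symm ζ))))
        (Complex.reCLM ∘L A.restrictScalars ℝ) (e p') := by
      refine (Complex.reCLM.hasFDerivAt.comp (e p') hAR).congr_of_eventuallyEq ?_
      filter_upwards [symm_mem_interior_nhds hp'e hp'] with ζ hζ
      simp only [hPdef, Function.comp, hφw, projCLM_apply,
        hφ.apply_proj _ (interior_subset hζ.2), Complex.reCLM_apply]
    rw [← c2.unique c3]
    exact c1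
  have him : HasFDerivAt (fun ζ => (projCLM (Y (e.symm ζ))).im)
      (Complex.imCLM ∘L A.restrictScalars ℝ) (e p') :=
    (Complex.imCLM.hasFDerivAt.comp (e p') hAR).congr_of_eventuallyEq
      (gim.mono fun ζ h => h.symm)
  have := hasFDerivAt_of_re_im (f := fun ζ => (⟨Q (proj (Y (e.symm ζ))) - Q z₀,
    (proj (Y (e.symm ζ))).im - z₀.im⟩ : ℂ)) (A := A.restrictScalars ℝ) (x := e p')
    (by simpa [projCLM_apply] using hre.sub_const (Q z₀))
    (by simpa [projCLM_apply] using him.sub_const z₀.im)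
  exact (hasFDerivAt_of_restrictScalars ℝ this rfl).differentiableAt

/-- The harmonic conjugate of the second coordinate has no critical point along the first
coordinate axis. -/
theorem IsGraphLift.fderiv_conjugate_ne_zero (hφ : IsGraphLift Y M Ω φ)
    (hM : IsSurfaceWithBoundary M B) (hY : IsConformalMinimalImmersion Y M B) {z₀ : ℂ}
    {Q : ℂ → ℝ} {w : ℂ} (hw : w ∈ interior Ω) (hQ : DifferentiableAt ℝ Q w)
    (hΦ : ∀ p ∈ interior M, ∀ e ∈ atlas ℂ R, p ∈ e.source →
        AnalyticAt ℂ (fun ζ => (⟨Q (proj (Y (e.symm ζ))),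
          (proj (Y (e.symm ζ))).im - z₀.im⟩ : ℂ)) (e p)) : fderiv ℝ Q w 1 ≠ 0 := by
  intro h0
  have hw' := interior_subset hw
  have hpM : φ w ∈ interior M := hφ.mem_interior_of_proj_mem hY.smooth (hφ.mapsTo w hw')
    (by rwa [hφ.proj_apply w hw'])
  set p := φ w with hp
  set e := chartAt ℂ p
  have hea : e ∈ atlas ℂ R := chart_mem_atlas ℂ p
  have hpe : p ∈ e.source := mem_chart_source ℂ p
  obtain ⟨L, hL⟩ := hφ.exists_hasFDerivAt_equiv hM hY hea hpe hpM
  have hXp : projCLM (Y (e.symm (e p))) = w := by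
    rw [e.left_inv hpe, projCLM_apply, hφ.proj_apply w hw']
  have hΨ := (hΦ p hpM e hea hpe).differentiableAt.hasDerivAt
  set d := deriv (fun ζ => (⟨Q (proj (Y (e.symm ζ))), (proj (Y (e.symm ζ))).im - z₀.im⟩ : ℂ)) (e p)
  have hR := hΨ.hasFDerivAt.restrictScalars ℝ
  have hre : HasFDerivAt (fun ζ => Q (proj (Y (e.symm ζ)))) _ (e p) :=
    Complex.reCLM.hasFDerivAt.comp (e p) hR
  have him : HasFDerivAt (fun ζ => (proj (Y (e.symm ζ))).im - z₀.im) _ (e p) :=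
    Complex.imCLM.hasFDerivAt.comp (e p) hR
  have hre' : HasFDerivAt (fun ζ => Q (projCLM (Y (e.symm ζ)))) (fderiv ℝ Q w ∘L ↑L) (e p) :=
    HasFDerivAt.comp (e p) (by rw [hXp]; exact hQ.hasFDerivAt) hL
  have him' : HasFDerivAt (fun ζ => (projCLM (Y (e.symm ζ))).im - z₀.im)
      (Complex.imCLM ∘L (L : ℂ →L[ℝ] ℂ)) (e p) :=
    (Complex.imCLM.hasFDerivAt.comp (e p) hL).sub_const _
  simp only [projCLM_apply] at hre' him'
  -- Along `L⁻¹ 1` both parts of the holomorphic function are stationary, forcing `d = 0`; along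
  -- `L⁻¹ i` its imaginary part has derivative 1.
  have e1 := DFunLike.congr_fun (hre.unique hre') (L.symm 1)
  have e2 := DFunLike.congr_fun (him.unique him') (L.symm 1)
  have e3 := DFunLike.congr_fun (him.unique him') (L.symm Complex.I)
  simp [h0] at e1 e2 e3
  have h4 : L.symm 1 * d = 0 := by
    apply Complex.ext <;> simp <;> assumption
  rcases mul_eq_zero.1 h4 with h | h
  · exact one_ne_zero ((map_eq_zero_iff L.symm L.symm.injective).1 h)
  · rw [h] at e3
    simp at e3

/-! ### Maximum principles on slabs and half-spaces -/

theorem norm_sq_eq_sum (x : E3) : ‖x‖ ^ 2 = x 0 ^ 2 + x 1 ^ 2 + x 2 ^ 2 := by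
  rw [← real_inner_self_eq_norm_sq, inner_eq_sum]
  ring

theorem continuous_coord (i : Fin 3) : Continuous fun x : E3 => x i := by fun_prop

/-- A maximum principle on a slab: a subharmonic function that is non-positive on the boundary and
on one face of the slab is controlled by a linear function and the slab barrier. -/
theorem IsGraphLift.slab_le (hφ : IsGraphLift Y M Ω φ) (hproper : IsProperMap (M.domRestrict Y))
    (hM : IsSurfaceWithBoundary M B) (hY : IsConformalMinimalImmersion Y M B) {ς : ℝ}
    (hς : ς = 1 ∨ ς = -1) {t₀ h c δ C : ℝ} (hc : 0 < c) (hδ : 0 < δ) (hC : 0 ≤ C)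
    (hr : ∀ q ∈ M, 0 ≤ ς * (Y q 1 - t₀) → ς * (Y q 1 - t₀) ≤ c →
      1 ≤ Y q 0 ^ 2 + (Y q 2 - h) ^ 2)
    {G : R → ℝ} (husc : UpperSemicontinuousOn G M) (hGC : ∀ q ∈ M, G q ≤ C)
    (hGB : ∀ q ∈ B, G q ≤ 0) (hG0 : ∀ q ∈ M, Y q 1 = t₀ → G q ≤ 0)
    (hG : ∀ q ∈ M \ B, Y q 1 ≠ t₀ →
      ∃ e ∈ atlas ℂ R, q ∈ e.source ∧ HarmonicAt (fun ζ => G (e.symm ζ)) (e q))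
    {p : R} (hp : p ∈ M) (hp0 : 0 ≤ ς * (Y p 1 - t₀)) (hpc : ς * (Y p 1 - t₀) ≤ c) :
    G p ≤ C / c * (ς * (Y p 1 - t₀)) +
      δ * (1 / 2 * Real.log (Y p 0 ^ 2 + (Y p 2 - h) ^ 2) - (Y p 1 - t₀) ^ 2 + c ^ 2) := by
  have hYc := hY.smooth.continuous
  have hco : ∀ i, Continuous fun q => Y q i := fun i => (continuous_coord i).comp hYc
  have hsq : ∀ q, (Y q 1 - t₀) ^ 2 = (ς * (Y q 1 - t₀)) ^ 2 := fun q => by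
    rcases hς with rfl | rfl <;> ring
  set b : E3 → ℝ := fun x => 1 / 2 * Real.log (x 0 ^ 2 + (x 2 - h) ^ 2) - (x 1 - t₀) ^ 2 with hb
  set τ : R → ℝ := fun q => ς * (Y q 1 - t₀) with hτ
  have hτc : Continuous τ := continuous_const.mul ((hco 1).sub continuous_const)
  -- The linear term reaches `C` on the far face and the `δ` term exceeds `C` far out, so within the
  -- slab `W > 0` only in a compact region off the boundary and the faces.
  set W : R → ℝ := fun q => G q + (-(C / c * τ q) - δ * (b (Y q) + c ^ 2)) with hW
  by_contra hlt
  have hWp : 0 < W p := by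
    simp only [hW, hb, hτ]
    linarith [not_le.1 hlt]
  have hbnn : ∀ q ∈ M, 0 ≤ τ q → τ q ≤ c → 0 ≤ b (Y q) + c ^ 2 := fun q hq h0 h1 => by
    have h2 := Real.log_nonneg (hr q hq h0 h1)
    have h3 : (Y q 1 - t₀) ^ 2 ≤ c ^ 2 := by
      rw [hsq]
      exact pow_le_pow_left₀ h0 h1 2
    simp only [hb]
    linarith
  -- This turns `δ (b + c²) < C` into `r² < E`, a comparison of continuous functions.
  set E : R → ℝ := fun q => Real.exp (2 * (C / δ - c ^ 2 + (Y q 1 - t₀) ^ 2)) with hE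
  have hEc : Continuous E := by
    have := hco 1
    fun_prop
  have hE_iff : ∀ q ∈ M, 0 ≤ τ q → τ q ≤ c →
      (Y q 0 ^ 2 + (Y q 2 - h) ^ 2 < E q ↔ δ * (b (Y q) + c ^ 2) < C) := fun q hq h0 h1 => by
    have hpos : 0 < Y q 0 ^ 2 + (Y q 2 - h) ^ 2 := one_pos.trans_le (hr q hq h0 h1)
    rw [hE, ← Real.log_lt_iff_lt_exp hpos, ← lt_div_iff₀' hδ]
    simp only [hb]
    constructor <;> intro h <;> linarith
  set A : Set R := {q ∈ M | 0 ≤ τ q ∧ τ q ≤ c ∧ Y q 0 ^ 2 + (Y q 2 - h) ^ 2 ≤ E q} with hA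
  have hpos : ∀ q ∈ M, 0 ≤ τ q → τ q ≤ c → 0 < W q →
      q ∉ B ∧ 0 < τ q ∧ τ q < c ∧ Y q 0 ^ 2 + (Y q 2 - h) ^ 2 < E q := fun q hq h0 h1 hWq => by
    have hbq := hbnn q hq h0 h1
    have hδb : 0 ≤ δ * (b (Y q) + c ^ 2) := mul_nonneg hδ.le hbq
    have hCτ : 0 ≤ C / c * τ q := mul_nonneg (div_nonneg hC hc.le) h0
    have hGq : 0 < G q := by simp only [hW] at hWq; linarith
    refine ⟨fun hqB => hGq.not_ge (hGB q hqB), lt_of_le_of_ne h0 fun h => ?_,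
      lt_of_le_of_ne h1 fun h => ?_, (hE_iff q hq h0 h1).2 ?_⟩
    · refine hGq.not_ge (hG0 q hq ?_)
      rcases hς with rfl | rfl <;> simp only [hτ] at h <;> linarith
    · have h3 : C / c * τ q = C := by rw [h]; field_simp
      have := hGC q hq
      simp only [hW] at hWq
      linarith
    · have := hGC q hq
      simp only [hW] at hWq
      linarith
  have hpA : p ∈ A := ⟨hp, hp0, hpc, (hpos p hp hp0 hpc hWp).2.2.2.le⟩
  have hAcomp : IsCompact A := by
    -- From `x² ≤ 2(x - a)² + 2a²` for the second and third coordinates, and `E ≤ exp (2C/δ)` within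
    -- the slab.
    set D := 2 * Real.exp (2 * (C / δ)) + 2 * h ^ 2 + 2 * c ^ 2 + 2 * t₀ ^ 2 with hD
    have hAsub : A ⊆ {q ∈ M | ‖Y q‖ ≤ Real.sqrt D} := fun q hq => by
      refine ⟨hq.1, Real.le_sqrt_of_sq_le ?_⟩
      have h3 : (Y q 1 - t₀) ^ 2 ≤ c ^ 2 := by
        rw [hsq]
        exact pow_le_pow_left₀ hq.2.1 hq.2.2.1 2
      have h4 : E q ≤ Real.exp (2 * (C / δ)) := Real.exp_le_exp.2 (by linarith)
      have h5 := hq.2.2.2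
      rw [norm_sq_eq_sum]
      nlinarith [sq_nonneg (Y q 2 - 2 * h), sq_nonneg (Y q 1 - 2 * t₀), sq_nonneg (Y q 0)]
    have hAeq : A = {q ∈ M | ‖Y q‖ ≤ Real.sqrt D} ∩
        {q | 0 ≤ τ q ∧ τ q ≤ c ∧ Y q 0 ^ 2 + (Y q 2 - h) ^ 2 ≤ E q} := by
      ext q
      exact ⟨fun hq => ⟨hAsub hq, hq.2⟩, fun hq => ⟨hq.1.1, hq.2⟩⟩
    rw [hAeq]
    refine (isCompact_norm_le hproper _).inter_right ?_
    refine (isClosed_le continuous_const hτc).inter ((isClosed_le hτc continuous_const).inter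
      (isClosed_le ?_ hEc))
    have := hco 0
    have := hco 2
    fun_prop
  have hWusc : UpperSemicontinuousOn W A := by
    refine UpperSemicontinuousOn.add (husc.mono fun q hq => hq.1)
      (ContinuousOn.upperSemicontinuousOn ?_)
    have hlog : ContinuousOn (fun q => Real.log (Y q 0 ^ 2 + (Y q 2 - h) ^ 2)) A := by
      refine ContinuousOn.log ?_ fun q hq => (one_pos.trans_le (hr q hq.1 hq.2.1 hq.2.2.1)).ne'
      have := hco 0
      have := hco 2
      exact Continuous.continuousOn (by fun_prop)
    have h1 := hτc.continuousOn (s := A)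
    have h2 := (hco 1).continuousOn (s := A)
    simp only [hb]
    fun_prop
  obtain ⟨q, hqA, hmax⟩ := hWusc.exists_isMaxOn ⟨p, hpA⟩ hAcomp
  have hWq : 0 < W q := hWp.trans_le (hmax hpA)
  obtain ⟨hqB, hq0, hqc, hqE⟩ := hpos q hqA.1 hqA.2.1 hqA.2.2.1 hWq
  have hqMB : q ∈ M \ B := ⟨hqA.1, hqB⟩
  have hqint : q ∈ interior M := by rw [hM.diff_eq] at hqMB; exact hqMB.1
  obtain ⟨e, he, hqe, hGe⟩ := hG q hqMB fun h => by
    simp only [hτ, h, sub_self, mul_zero, lt_self_iff_false] at hq0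
  have hnear : ∀ᶠ q' in 𝓝 q, q' ∈ A := by
    have hc1 : Continuous fun q => Y q 0 ^ 2 + (Y q 2 - h) ^ 2 := by
      have := hco 0
      have := hco 2
      fun_prop
    filter_upwards [hM.isOpen_diff.mem_nhds hqMB, hτc.continuousAt.eventually_const_lt hq0,
      hτc.continuousAt.eventually_lt_const hqc, hc1.continuousAt.eventually_lt
        hEc.continuousAt hqE] with q' h1 h2 h3 h4
    exact ⟨h1.1, h2.le, h3.le, h4.le⟩
  set F : ℂ → E3 := Y ∘ e.symm with hF
  have hFx : F (e q) = Y q := by simp [hF, e.left_inv hqe]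
  have hFsm : ContDiffAt ℝ 2 F (e q) :=
    (contDiffAt_comp_symm hY.smooth he (e.map_source hqe)).of_le ENat.LEInfty.out
  obtain ⟨hlap, hconf⟩ := hY.laplacian_eq_zero hM he hqe hqint
  have hcrit : fderiv ℝ (fun ζ => F ζ 1) (e q) ≠ 0 := by
    have h1 := hφ.fderiv_comp_ne_zero hM hY he hqe hqint (l := Complex.imCLM) fun h => by
      simpa using DFunLike.congr_fun h Complex.I
    simpa [projCLM_apply, proj, hF] using h1
  obtain ⟨hsc, hsl⟩ := laplacian_slabBarrier_neg hFsm hlap hconf h t₀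
    (by rw [hFx]; exact hr q hqA.1 hqA.2.1 hqA.2.2.1) hcrit
  have hlin : HarmonicAt (fun ζ => F ζ 1) (e q) :=
    hY.harmonicAt_comp hM he hqe hqint (EuclideanSpace.proj 1)
  -- In the chart `W` is the harmonic `H` minus `δ` times a strictly superharmonic function. Its
  -- Laplacian is positive, which excludes a local maximum.
  set H : ℂ → ℝ := (fun ζ => G (e.symm ζ)) - (C / c * ς) • (fun ζ => F ζ 1) +
    (fun _ => C / c * ς * t₀ - δ * c ^ 2) with hH
  have hHharm : HarmonicAt H (e q) :=
    (hGe.sub hlin.const_smul).add (harmonicAt_const _)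
  have hWH : (fun ζ => W (e.symm ζ)) = H - δ • slabBarrier F h t₀ := by
    funext ζ
    simp only [hW, hH, hb, hτ, hF, slabBarrier, Pi.add_apply, Pi.sub_apply, Pi.smul_apply,
      smul_eq_mul, Function.comp]
    ring
  have hδs : ContDiffAt ℝ 2 (δ • slabBarrier F h t₀) (e q) := hsc.const_smul δ
  have hloc : IsLocalMax (fun ζ => W (e.symm ζ)) (e q) := by
    filter_upwards [(e.tendsto_symm hqe).eventually hnear] with ζ hζ
    rw [e.left_inv hqe]
    exact hmax hζ
  rw [hWH] at hloc
  have hle : Δ (H - δ • slabBarrier F h t₀) (e q) ≤ 0 :=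
    laplacian_nonpos_of_isLocalMax (hHharm.1.sub hδs) hloc
  rw [hHharm.1.laplacian_sub hδs, laplacian_smul δ hsc, hHharm.2.self_of_nhds] at hle
  simp only [Pi.zero_apply, smul_eq_mul] at hle
  nlinarith

/-- A maximum principle on a half-space for functions bounded above on a minimal graph. -/
theorem IsGraphLift.halfSpace_le (hφ : IsGraphLift Y M Ω φ)
    (hproper : IsProperMap (M.domRestrict Y)) (hΩ : IsClosed Ω)
    (hM : IsSurfaceWithBoundary M B) (hY : IsConformalMinimalImmersion Y M B) {t₀ C : ℝ}
    {G : R → ℝ} (husc : UpperSemicontinuousOn G M) (hGC : ∀ q ∈ M, G q ≤ C)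
    (hGB : ∀ q ∈ B, G q ≤ 0) (hG0 : ∀ q ∈ M, Y q 1 = t₀ → G q ≤ 0)
    (hG : ∀ q ∈ M \ B, Y q 1 ≠ t₀ →
      ∃ e ∈ atlas ℂ R, q ∈ e.source ∧ HarmonicAt (fun ζ => G (e.symm ζ)) (e q))
    {p : R} (hp : p ∈ M) : G p ≤ 0 := by
  obtain ⟨ς, hς, hp0⟩ : ∃ ς : ℝ, (ς = 1 ∨ ς = -1) ∧ 0 ≤ ς * (Y p 1 - t₀) := by
    rcases le_total 0 (Y p 1 - t₀) with h | h
    · exact ⟨1, Or.inl rfl, by linarith⟩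
    · exact ⟨-1, Or.inr rfl, by linarith⟩
  set τ := ς * (Y p 1 - t₀) with hτ
  set C' := max C 0 with hC'
  have key : ∀ c, τ < c → G p ≤ C' / c * τ := by
    intro c hτc
    have hc : 0 < c := hp0.trans_lt hτc
    -- the third coordinate is bounded on the part of the slab near the barrier axis
    obtain ⟨H, hH⟩ : ∃ H : ℝ, ∀ q ∈ M, |Y q 0| ≤ 1 → 0 ≤ ς * (Y q 1 - t₀) →
        ς * (Y q 1 - t₀) ≤ c → |Y q 2| ≤ H := by
      set S : Set ℂ := Ω ∩ (Icc (-1) 1 ×ℂ Icc (t₀ - c) (t₀ + c)) with hS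
      have hScomp : IsCompact S := (isCompact_Icc.reProdIm isCompact_Icc).inter_left hΩ
      have hcont : ContinuousOn (fun w => Y (φ w) 2) S :=
        ((continuous_coord 2).comp hY.smooth.continuous).comp_continuousOn
          (hφ.continuousOn.mono inter_subset_left)
      obtain ⟨H, hH⟩ := hScomp.exists_bound_of_continuousOn hcont
      refine ⟨H, fun q hq h0 h1 h2 => ?_⟩
      have := hH (proj (Y q)) ⟨hφ.proj_mem q hq, ⟨abs_le.1 h0, ?_⟩⟩
      · simpa [hφ.apply_proj q hq] using this
      · change Y q 1 ∈ Icc (t₀ - c) (t₀ + c)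
        rcases hς with rfl | rfl <;> constructor <;> linarith
    have hr : ∀ q ∈ M, 0 ≤ ς * (Y q 1 - t₀) → ς * (Y q 1 - t₀) ≤ c →
        1 ≤ Y q 0 ^ 2 + (Y q 2 - (H + 1)) ^ 2 := fun q hq h0 h1 => by
      by_cases hx : |Y q 0| ≤ 1
      · have := abs_le.1 (hH q hq hx h0 h1)
        nlinarith [sq_nonneg (Y q 0)]
      · have h2 : 1 < |Y q 0| := not_le.1 hx
        have h3 := sq_abs (Y q 0)
        nlinarith [sq_nonneg (Y q 2 - (H + 1))]
    have hδ : ∀ δ > 0, G p ≤ C' / c * τ + δ * (1 / 2 * Real.log (Y p 0 ^ 2 +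
        (Y p 2 - (H + 1)) ^ 2) - (Y p 1 - t₀) ^ 2 + c ^ 2) := fun δ hδ =>
      hφ.slab_le hproper hM hY hς hc hδ (le_max_right _ _) hr husc
        (fun q hq => (hGC q hq).trans (le_max_left _ _)) hGB hG0 hG hp hp0 hτc.le
    set κ := 1 / 2 * Real.log (Y p 0 ^ 2 + (Y p 2 - (H + 1)) ^ 2) - (Y p 1 - t₀) ^ 2 + c ^ 2
    have hlim : Tendsto (fun δ : ℝ => C' / c * τ + δ * κ) (𝓝[>] 0) (𝓝 (C' / c * τ)) := by
      have : Tendsto (fun δ : ℝ => C' / c * τ + δ * κ) (𝓝 0) (𝓝 (C' / c * τ + 0 * κ)) :=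
        Continuous.tendsto (by fun_prop) 0
      rw [zero_mul, add_zero] at this
      exact this.mono_left nhdsWithin_le_nhds
    exact ge_of_tendsto hlim (eventually_mem_nhdsWithin.mono hδ)
  -- After `δ → 0` with the slab fixed, widening the slab removes the linear term.
  have hlim : Tendsto (fun c : ℝ => C' / c * τ) atTop (𝓝 (0 * τ)) :=
    (tendsto_const_nhds.div_atTop tendsto_id).mul_const τ
  rw [zero_mul] at hlim
  exact ge_of_tendsto hlim ((eventually_gt_atTop τ).mono key)

end Conjugate

/-! ### Monotone functions on the slice -/

/-- A function without critical points on an open interval is strictly monotone there. -/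
theorem strictMonoOn_or_strictAntiOn_of_deriv_ne_zero {J : Set ℝ} (hJ : IsOpen J)
    (hJc : Convex ℝ J) {θ : ℝ → ℝ} (hd : ∀ y ∈ J, DifferentiableAt ℝ θ y)
    (hne : ∀ y ∈ J, deriv θ y ≠ 0) : StrictMonoOn θ J ∨ StrictAntiOn θ J := by
  have hcont : ContinuousOn θ J := fun y hy => (hd y hy).continuousAt.continuousWithinAt
  rcases hasDerivWithinAt_forall_lt_or_forall_gt_of_forall_ne hJc
    (fun y hy => (hd y hy).hasDerivAt.hasDerivWithinAt) hne with h | h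
  · exact Or.inr (strictAntiOn_of_deriv_neg hJc hcont (by rwa [hJ.interior_eq]))
  · exact Or.inl (strictMonoOn_of_deriv_pos hJc hcont (by rwa [hJ.interior_eq]))

theorem isOpen_image_of_strictMonoOn_or {J : Set ℝ} (hJ : IsOpen J) {θ : ℝ → ℝ}
    (hcont : ContinuousOn θ J) (hmono : StrictMonoOn θ J ∨ StrictAntiOn θ J) :
    IsOpen (θ '' J) := by
  rw [isOpen_iff_mem_nhds]
  rintro _ ⟨y, hy, rfl⟩
  obtain ⟨η, hη, hball⟩ := Metric.nhds_basis_closedBall.mem_iff.1 (hJ.mem_nhds hy)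
  rw [Real.closedBall_eq_Icc] at hball
  have hl : y - η ∈ J := hball ⟨le_rfl, by linarith⟩
  have hu : y + η ∈ J := hball ⟨by linarith, le_rfl⟩
  have hivt := intermediate_value_uIcc (a := y - η) (b := y + η) (f := θ)
    (hcont.mono (by rw [uIcc_of_le (by linarith)]; exact hball))
  refine mem_of_superset ?_ (hivt.trans (image_mono
    (by rw [uIcc_of_le (by linarith)]; exact hball)))
  rcases hmono with h | h
  · have h1 := h hl hy (by linarith)
    have h2 := h hy hu (by linarith)
    rw [uIcc_of_le (h1.trans h2).le]
    exact Icc_mem_nhds h1 h2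
  · have h1 := h hl hy (by linarith)
    have h2 := h hy hu (by linarith)
    rw [uIcc_of_ge (h2.trans h1).le]
    exact Icc_mem_nhds h2 h1

theorem exists_Icc_of_mem_Icc_image {J : Set ℝ} {θ : ℝ → ℝ}
    (hmono : StrictMonoOn θ J ∨ StrictAntiOn θ J) {x₀ x₁ : ℝ} (hx₀ : x₀ ∈ θ '' J)
    (hx₁ : x₁ ∈ θ '' J) : ∃ y₀ ∈ J, ∃ y₁ ∈ J, ∀ y ∈ J, θ y ∈ Icc x₀ x₁ → y ∈ Icc y₀ y₁ := by
  obtain ⟨y₀, hy₀, rfl⟩ := hx₀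
  obtain ⟨y₁, hy₁, rfl⟩ := hx₁
  rcases hmono with h | h
  · exact ⟨y₀, hy₀, y₁, hy₁, fun y hy hθ => ⟨(h.le_iff_le hy₀ hy).1 hθ.1, (h.le_iff_le hy hy₁).1 hθ.2⟩⟩
  · exact ⟨y₁, hy₁, y₀, hy₀, fun y hy hθ => ⟨(h.le_iff_ge hy hy₁).1 hθ.2, (h.le_iff_ge hy₀ hy).1 hθ.1⟩⟩

/-! ### Strong maximum principle and relative parabolicity -/

section StrongMaximum

variable {R : Type*} [TopologicalSpace R] {M : Set R}

/-- The strong maximum principle at an interior maximum. -/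
theorem eventually_eq_of_forall_le {G : R → ℝ} {e : OpenPartialHomeomorph R ℂ} {p : R}
    (hp : p ∈ e.source) (hpM : p ∈ interior M) (hG : HarmonicAt (fun ζ => G (e.symm ζ)) (e p))
    (hmax : ∀ q ∈ M, G q ≤ G p) : ∀ᶠ q in 𝓝 p, G q = G p := by
  have hloc : IsLocalMax (fun ζ => G (e.symm ζ)) (e p) := by
    filter_upwards [symm_mem_interior_nhds hp hpM] with ζ hζ
    rw [e.left_inv hp]
    exact hmax _ (interior_subset hζ.2)
  have h := eventually_eq_of_harmonicAt_of_isLocalMax hG hloc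
  filter_upwards [(e.continuousAt hp).eventually h, e.open_source.mem_nhds hp] with q hq hqs
  simpa [e.left_inv hp, e.left_inv hqs] using hq

end StrongMaximum

section Parabolic

variable {R : Type*} [TopologicalSpace R] [ChartedSpace ℂ R] [IsManifold 𝓘(ℂ) ω R]
  {Y : R → E3} {M B : Set R} {Ω : Set ℂ} {φ : ℂ → R}

theorem IsGraphLift.apply_mem_interior (hφ : IsGraphLift Y M Ω φ)
    (hY : IsConformalMinimalImmersion Y M B) {w : ℂ} (hw : w ∈ interior Ω) :
    φ w ∈ interior M :=
  hφ.mem_interior_of_proj_mem hY.smooth (hφ.mapsTo w (interior_subset hw))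
    (by rwa [hφ.proj_apply w (interior_subset hw)])

/-- A bounded harmonic function that vanishes on the boundary is bounded above by zero or by its
value at some interior point. -/
theorem IsGraphLift.exists_forall_le_max (hφ : IsGraphLift Y M Ω φ)
    (hproper : IsProperMap (M.domRestrict Y)) (hΩ : IsClosed Ω)
    (hM : IsSurfaceWithBoundary M B) (hY : IsConformalMinimalImmersion Y M B) {z₀ : ℂ}
    (hz₀ : z₀ ∈ interior Ω) (hstar : StarConvex ℝ z₀ Ω) {f : R → ℝ} (hf : ContinuousOn f M)
    {C : ℝ} (hC : ∀ p ∈ M, |f p| ≤ C) (hharm : ∀ p ∈ M \ B, IsHarmonicAt f p)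
    (hfB : ∀ p ∈ B, f p = 0) : ∃ q ∈ M, ∀ p ∈ M, f p ≤ max (f q) 0 := by
  obtain ⟨Q, hQ0, hQd, hΦ⟩ := hφ.exists_conjugate hM hY hz₀ hstar
  set Φ : ℂ → ℂ := fun w => ⟨Q w, w.im - z₀.im⟩ with hΦdef
  set J : Set ℝ := {y : ℝ | z₀ + y ∈ interior Ω} with hJdef
  set θ : ℝ → ℝ := fun y => Q (z₀ + y) with hθdef
  have hline : Continuous fun y : ℝ => z₀ + (y : ℂ) := by fun_prop
  have hJo : IsOpen J := isOpen_interior.preimage hline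
  have hJ0 : (0 : ℝ) ∈ J := by simpa [hJdef] using hz₀
  have hJc : Convex ℝ J := by
    have hsc : StarConvex ℝ (0 : ℝ) J := by
      intro y hy a b ha hb hab
      have := starConvex_interior hz₀ hstar hy ha hb hab
      have h2 : z₀ + ((a • (0 : ℝ) + b • y : ℝ) : ℂ) = a • z₀ + b • (z₀ + (y : ℂ)) := by
        have h3 : (a : ℂ) + b = 1 := by exact_mod_cast hab
        simp only [smul_eq_mul, Complex.real_smul]
        push_cast
        linear_combination (-z₀) * h3
      rw [hJdef, mem_ofPred_eq, h2]
      exact this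
    exact (hsc.isPathConnected hJ0).isConnected.isPreconnected.ordConnected.convex
  have hθdiff : ∀ y ∈ J, HasDerivAt θ (fderiv ℝ Q (z₀ + y) 1) y := fun y hy => by
    have h1 : HasDerivAt (fun y : ℝ => z₀ + (y : ℂ)) 1 y := by
      simpa using (Complex.ofRealCLM.hasDerivAt (x := y)).const_add z₀
    exact (hQd _ hy).hasFDerivAt.comp_hasDerivAt y h1
  have hθc : ContinuousOn θ J := fun y hy => (hθdiff y hy).continuousAt.continuousWithinAt
  have hmono := strictMonoOn_or_strictAntiOn_of_deriv_ne_zero hJo hJc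
    (fun y hy => (hθdiff y hy).differentiableAt) (fun y hy => by
      rw [(hθdiff y hy).deriv]
      exact hφ.fderiv_conjugate_ne_zero hM hY hy (hQd _ hy) hΦ)
  set I := θ '' J with hI
  have hIo : IsOpen I := isOpen_image_of_strictMonoOn_or hJo hθc hmono
  have hI0 : (0 : ℝ) ∈ I := ⟨0, hJ0, by simp [hθdef, hQ0]⟩
  obtain ⟨η, hη, hball⟩ := Metric.isOpen_iff.1 hIo 0 hI0
  have hIη : ∀ x : ℝ, |x| < η → x ∈ I := fun x hx => hball (by simpa using hx)
  -- Half the radius leaves points of `I` on both sides of the slit, as the construction of the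
  -- poles requires.
  set r := η / 2 with hrdef
  have hr : 0 < r := by positivity
  obtain ⟨a, b, ha, hb, hpole, hproperV⟩ := exists_slitBarrier hr hIo
    ⟨3 * η / 4, hIη _ (by rw [abs_of_pos (by positivity)]; linarith), by rw [hrdef]; linarith⟩
    ⟨-(3 * η / 4), hIη _ (by rw [abs_neg, abs_of_pos (by positivity)]; linarith),
      by rw [hrdef]; linarith⟩
  set Seg := Complex.ofReal '' Icc (-r) r with hSeg
  have hslit0 : ∀ w ∈ Seg, slitBarrier r a b w = 0 := fun w hw => by
    simp only [slitBarrier]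
    rw [if_pos hw]
  classical
  -- Where `V` is set to 0, its nonnegativity alone makes `-ε V` upper semicontinuous; no continuity
  -- up to the slit or the boundary is needed.
  set V : R → ℝ := fun p => if p ∈ interior M then slitBarrier r a b (Φ (proj (Y p))) else 0
    with hV
  have hV0 : ∀ p, 0 ≤ V p := fun p => by
    simp only [hV]
    split_ifs
    · exact slitBarrier_nonneg ha hb _
    · exact le_rfl
  have haxis : ∀ p ∈ interior M, (Φ (proj (Y p))).im = 0 →
      ∃ y ∈ J, p = φ (z₀ + y) ∧ θ y = (Φ (proj (Y p))).re := fun p hp him => by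
    have hw := hφ.proj_mem_interior hM hY hp
    have h1 : proj (Y p) = z₀ + (((proj (Y p)).re - z₀.re : ℝ) : ℂ) := by
      apply Complex.ext
      · simp
      · simp only [hΦdef] at him
        simp only [Complex.add_im, Complex.ofReal_im, add_zero]
        linarith
    refine ⟨(proj (Y p)).re - z₀.re, ?_, ?_, ?_⟩
    · rw [hJdef, mem_ofPred_eq, ← h1]
      exact hw
    · rw [← h1, hφ.apply_proj p (interior_subset hp)]
    · simp only [hθdef, hΦdef]
      rw [← h1]
  have hVharm : ∀ p ∈ interior M, Φ (proj (Y p)) ∉ Seg → ∀ e ∈ atlas ℂ R, p ∈ e.source →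
      HarmonicAt (fun ζ => V (e.symm ζ)) (e p) := fun p hp hseg e he hpe => by
    have hx : Φ (proj (Y (e.symm (e p)))) = Φ (proj (Y p)) := by rw [e.left_inv hpe]
    have h1 := harmonicAt_slitBarrier_comp (a := a) (b := b) hr (hΦ p hp e he hpe)
      (x := e p) (by rw [hΦdef] at hx hseg; simp only at hx hseg; rwa [hx])
      (fun e' he' => by
        rw [hΦdef] at hx
        simp only at hx
        rw [hx]
        refine hpole _ hseg (fun him => ?_) e' he'
        obtain ⟨y, hy, -, hθy⟩ := haxis p hp him
        exact ⟨y, hy, hθy⟩) ha hb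
    refine (harmonicAt_congr_nhds ?_).2 h1
    filter_upwards [symm_mem_interior_nhds hpe hp] with ζ hζ
    simp only [hV, if_pos hζ.2]
    rfl
  -- the compact subset of the axis where the barrier vanishes
  have hrI : ∀ x ∈ Icc (-r) r, x ∈ I := fun x hx => hIη x (by
    have := abs_le.2 hx
    have : r < η := by rw [hrdef]; linarith
    linarith)
  obtain ⟨y₀, hy₀, y₁, hy₁, hyr⟩ := exists_Icc_of_mem_Icc_image hmono
    (hrI (-r) ⟨le_rfl, by linarith⟩) (hrI r ⟨by linarith, le_rfl⟩)
  have hφline : ContinuousOn (fun y : ℝ => φ (z₀ + y)) J :=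
    hφ.continuousOn.comp hline.continuousOn fun y hy => interior_subset hy
  have hJM : ∀ y ∈ J, φ (z₀ + y) ∈ interior M := fun y hy => hφ.apply_mem_interior hY hy
  have hJsub : Icc y₀ y₁ ⊆ J := hJc.ordConnected.out hy₀ hy₁
  set K : Set ℝ := Icc y₀ y₁ ∩ θ ⁻¹' Icc (-r) r with hKdef
  have hKc : IsCompact K := isCompact_Icc.of_isClosed_subset
    ((hθc.mono hJsub).preimage_isClosed_of_isClosed isClosed_Icc isClosed_Icc) inter_subset_left
  have hK0 : (0 : ℝ) ∈ K := by
    have h0 : θ 0 ∈ Icc (-r) r := by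
      simp only [hθdef, Complex.ofReal_zero, add_zero, hQ0]
      exact ⟨by linarith, hr.le⟩
    exact ⟨hyr 0 hJ0 h0, h0⟩
  have hfK : ContinuousOn (fun y : ℝ => f (φ (z₀ + y))) K :=
    hf.comp (hφline.mono (inter_subset_left.trans hJsub)) fun y hy =>
      interior_subset (hJM y (hJsub hy.1))
  obtain ⟨k, hkK, hkmax⟩ := hKc.exists_isMaxOn ⟨0, hK0⟩ hfK
  refine ⟨φ (z₀ + k), interior_subset (hJM k (hJsub hkK.1)), ?_⟩
  set s := max (f (φ (z₀ + k))) 0 with hs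
  have hs0 : 0 ≤ s := le_max_right _ _
  have hfs : ∀ p ∈ interior M, Φ (proj (Y p)) ∈ Seg → f p ≤ s := fun p hp hseg => by
    obtain ⟨x, hx, hxΦ⟩ := hseg
    obtain ⟨y, hy, hpy, hθy⟩ := haxis p hp (by rw [← hxΦ]; simp)
    have hθr : θ y ∈ Icc (-r) r := by rw [hθy, ← hxΦ]; simpa using hx
    rw [hpy]
    exact (hkmax (show y ∈ K from ⟨hyr y hy hθr, hθr⟩)).trans (le_max_left _ _)
  have hC0 : 0 ≤ C := (abs_nonneg _).trans (hC _ (interior_subset (hJM 0 hJ0)))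
  suffices key : ∀ ε > 0, ∀ p ∈ M, f p - s - ε * V p ≤ 0 by
    intro p hp
    have hlim : Tendsto (fun ε : ℝ => s + ε * V p) (𝓝[>] 0) (𝓝 s) := by
      have : Tendsto (fun ε : ℝ => s + ε * V p) (𝓝 0) (𝓝 (s + 0 * V p)) :=
        Continuous.tendsto (by fun_prop) 0
      rw [zero_mul, add_zero] at this
      exact this.mono_left nhdsWithin_le_nhds
    refine ge_of_tendsto hlim (eventually_mem_nhdsWithin.mono fun ε hε => ?_)
    linarith [key ε hε p hp]
  intro ε hε
  set G : R → ℝ := fun p => f p - s - ε * V p with hG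
  have hGC : ∀ p ∈ M, G p ≤ C := fun p hp => by
    have := (abs_le.1 (hC p hp)).2
    have := mul_nonneg hε.le (hV0 p)
    simp only [hG]
    linarith
  have hGB : ∀ p ∈ B, G p ≤ 0 := fun p hp => by
    have := hfB p hp
    have := mul_nonneg hε.le (hV0 p)
    simp only [hG]
    linarith
  have hGharm : ∀ p ∈ M \ B, Φ (proj (Y p)) ∉ Seg → ∀ e ∈ atlas ℂ R, p ∈ e.source →
      HarmonicAt (fun ζ => G (e.symm ζ)) (e p) := fun p hp hseg e he hpe => by
    have hpi : p ∈ interior M := by rw [hM.diff_eq] at hp; exact hp.1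
    have h1 := ((hharm p hp e he hpe).sub (harmonicAt_const s)).sub
      ((hVharm p hpi hseg e he hpe).const_smul (c := ε))
    exact h1
  have hGusc : UpperSemicontinuousOn G M := by
    have hVusc : UpperSemicontinuousOn (fun p => -(ε * V p)) M := by
      intro p hp
      by_cases hpi : p ∈ interior M ∧ Φ (proj (Y p)) ∉ Seg
      · have h1 := (hVharm p hpi.1 hpi.2 _ (chart_mem_atlas ℂ p)
          (mem_chart_source ℂ p)).1.continuousAt
        have h2 : ContinuousAt V p := by
          have h3 : ContinuousAt (fun q => V ((chartAt ℂ p).symm (chartAt ℂ p q))) p :=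
            ContinuousAt.comp (f := chartAt ℂ p) h1
              ((chartAt ℂ p).continuousAt (mem_chart_source ℂ p))
          refine h3.congr ?_
          filter_upwards [(chartAt ℂ p).open_source.mem_nhds (mem_chart_source ℂ p)] with q hq
          rw [(chartAt ℂ p).left_inv hq]
        exact (continuousAt_const.mul h2).neg.continuousWithinAt.upperSemicontinuousWithinAt
      · have hVp : V p = 0 := by
          simp only [hV]
          split_ifs with h
          · exact hslit0 _ (not_not.1 fun h' => hpi ⟨h, h'⟩)
          · rfl
        refine upperSemicontinuousWithinAt_iff.2 fun y hy => ?_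
        refine Eventually.of_forall fun q => lt_of_le_of_lt ?_ hy
        have := mul_nonneg hε.le (hV0 q)
        simp only [hVp]
        linarith
    have h1 : UpperSemicontinuousOn (fun p => f p - s) M :=
      (hf.sub continuousOn_const).upperSemicontinuousOn
    have h2 := h1.add hVusc
    have hGeq : G = fun p => f p - s + -(ε * V p) := by
      funext p
      simp only [hG]
      ring
    rw [hGeq]
    exact h2
  have hnotSeg : ∀ p ∈ M, 0 < G p → p ∈ M \ B ∧ Φ (proj (Y p)) ∉ Seg := fun p hp hpos => by
    have hpB : p ∉ B := fun h => (hGB p h).not_gt hpos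
    have hpi : p ∈ interior M := by
      have : p ∈ M \ B := ⟨hp, hpB⟩
      rw [hM.diff_eq] at this
      exact this.1
    refine ⟨⟨hp, hpB⟩, fun hseg => ?_⟩
    have := hfs p hpi hseg
    have := mul_nonneg hε.le (hV0 p)
    simp only [hG] at hpos
    linarith
  -- The half-space principle for `G - m`: a nonnegative bound on the slice is a bound on all of
  -- `M`.
  have hbound : ∀ m : ℝ, 0 ≤ m → (∀ y ∈ J, G (φ (z₀ + y)) ≤ m) → ∀ p ∈ M, G p ≤ m := by
    intro m hm hJm p hp
    have h := hφ.halfSpace_le hproper hΩ hM hY (t₀ := z₀.im) (C := C) (G := fun q => G q + -m)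
      (hGusc.add upperSemicontinuousOn_const) (fun q hq => by linarith [hGC q hq])
      (fun q hq => by linarith [hGB q hq]) (fun q hq hq0 => ?_) (fun q hq hq0 => ?_) hp
    · linarith
    · by_cases hqi : q ∈ interior M
      · obtain ⟨y, hy, hqy, -⟩ := haxis q hqi (by
          change Y q 1 - z₀.im = 0
          rw [hq0, sub_self])
        have := hJm y hy
        rw [← hqy] at this
        linarith
      · have := hGB q (hM.frontier_subset ⟨subset_closure hq, hqi⟩)
        linarith
    · refine ⟨_, chart_mem_atlas ℂ q, mem_chart_source ℂ q,
        (hGharm q hq (fun hseg => hq0 ?_) _ (chart_mem_atlas ℂ q) (mem_chart_source ℂ q)).add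
          (harmonicAt_const (-m))⟩
      obtain ⟨x, -, hx⟩ := hseg
      have : (Φ (proj (Y q))).im = 0 := by rw [← hx]; simp
      exact sub_eq_zero.1 this
  refine hbound 0 le_rfl fun y hy => ?_
  by_contra hpos
  rw [not_le] at hpos
  -- the supremum over the axis is attained
  obtain ⟨x₀, hx₀, x₁, hx₁, hxV⟩ := hproperV (C / ε)
  obtain ⟨v₀, hv₀, v₁, hv₁, hv⟩ := exists_Icc_of_mem_Icc_image hmono hx₀ hx₁
  have hVaxis : ∀ y ∈ J, V (φ (z₀ + y)) = slitBarrier r a b (θ y) := fun y hy => by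
    simp only [hV, if_pos (hJM y hy), hφ.proj_apply _ (interior_subset hy)]
    congr 1
    apply Complex.ext <;> simp [hΦdef, hθdef]
  have hmemv : ∀ y ∈ J, 0 < G (φ (z₀ + y)) → y ∈ Icc v₀ v₁ := fun y hy hGy => by
    refine hv y hy (hxV (θ y) ⟨y, hy, rfl⟩ ?_)
    rw [← hVaxis y hy, le_div_iff₀' hε]
    have := (abs_le.1 (hC _ (interior_subset (hJM y hy)))).2
    simp only [hG] at hGy
    linarith
  have hvJ : Icc v₀ v₁ ⊆ J := hJc.ordConnected.out hv₀ hv₁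
  have huscJ : UpperSemicontinuousOn (G ∘ fun y : ℝ => φ (z₀ + y)) J :=
    hGusc.comp hφline fun y hy => interior_subset (hJM y hy)
  obtain ⟨v, hvI, hvmax⟩ := (huscJ.mono hvJ).exists_isMaxOn ⟨y, hmemv y hy hpos⟩ isCompact_Icc
  have hvmax' : ∀ y' ∈ Icc v₀ v₁, G (φ (z₀ + y')) ≤ G (φ (z₀ + v)) := fun y' hy' => hvmax hy'
  set m := G (φ (z₀ + v)) with hm
  have hmpos : 0 < m := hpos.trans_le (hvmax' y (hmemv y hy hpos))
  have hmJ : ∀ y' ∈ J, G (φ (z₀ + y')) ≤ m := fun y' hy' => by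
    by_cases h : 0 < G (φ (z₀ + y'))
    · exact hvmax' y' (hmemv y' hy' h)
    · exact (not_lt.1 h).trans hmpos.le
  have hmM := hbound m hmpos.le hmJ
  -- The set where `G = m` is open by the strong maximum principle, the set where `G < m` by upper
  -- semicontinuity, and `J` is connected.
  have hall : J ⊆ {y ∈ J | G (φ (z₀ + y)) = m} := by
    refine IsPreconnected.subset_left_of_subset_union (v := {y ∈ J | G (φ (z₀ + y)) < m})
      ?_ ?_ ?_ ?_ ⟨v, hvJ hvI, hvJ hvI, rfl⟩ hJc.isPreconnected
    · rw [isOpen_iff_mem_nhds]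
      rintro y' ⟨hy', hGy'⟩
      have hpi := hJM y' hy'
      obtain ⟨hpMB, hseg⟩ := hnotSeg _ (interior_subset hpi) (by rw [hGy']; exact hmpos)
      have hev := eventually_eq_of_forall_le (mem_chart_source ℂ _) hpi
        (hGharm _ hpMB hseg _ (chart_mem_atlas ℂ _) (mem_chart_source ℂ _))
        (fun q hq => by rw [hGy']; exact hmM q hq)
      have hc : ContinuousAt (fun y : ℝ => φ (z₀ + y)) y' :=
        hφline.continuousAt (hJo.mem_nhds hy')
      filter_upwards [hJo.mem_nhds hy', hc.eventually hev] with x hx hx'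
      exact ⟨hx, hx'.trans hGy'⟩
    · rw [isOpen_iff_mem_nhds]
      rintro y' ⟨hy', hGy'⟩
      have h := (upperSemicontinuousWithinAt_iff.1 (huscJ y' hy')) m hGy'
      rw [hJo.nhdsWithin_eq hy'] at h
      filter_upwards [hJo.mem_nhds hy', h] with x hx hx'
      exact ⟨hx, hx'⟩
    · rw [Set.disjoint_left]
      rintro x ⟨-, h1⟩ ⟨-, h2⟩
      exact h2.ne h1
    · intro x hx
      rcases (hmJ x hx).eq_or_lt with h | h
      · exact Or.inl ⟨hx, h⟩
      · exact Or.inr ⟨hx, h⟩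
  -- At `0 ∈ J` the value of `Φ` is 0, on the slit, where `G` cannot be positive.
  have h0 := (hall hJ0).2
  refine (hnotSeg _ (interior_subset (hJM 0 hJ0)) (by rw [h0]; exact hmpos)).2 ⟨0, ?_, ?_⟩
  · exact ⟨by linarith, hr.le⟩
  · rw [hφ.proj_apply _ (interior_subset hJ0)]
    apply Complex.ext <;> simp [hΦdef, hQ0]

/-- A bounded harmonic function that vanishes on the boundary of a minimal graph over a starlike
domain is non-positive. -/
theorem IsGraphLift.harmonic_nonpos (hφ : IsGraphLift Y M Ω φ)
    (hproper : IsProperMap (M.domRestrict Y)) (hΩ : IsClosed Ω)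
    (hM : IsSurfaceWithBoundary M B) (hB : B.Nonempty) (hY : IsConformalMinimalImmersion Y M B)
    {z₀ : ℂ} (hz₀ : z₀ ∈ interior Ω) (hstar : StarConvex ℝ z₀ Ω) {f : R → ℝ}
    (hf : ContinuousOn f M) {C : ℝ} (hC : ∀ p ∈ M, |f p| ≤ C)
    (hharm : ∀ p ∈ M \ B, IsHarmonicAt f p) (hfB : ∀ p ∈ B, f p = 0) {p : R} (hp : p ∈ M) :
    f p ≤ 0 := by
  obtain ⟨q, hq, hmax⟩ := hφ.exists_forall_le_max hproper hΩ hM hY hz₀ hstar hf hC hharm hfB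
  rcases le_or_gt (f q) 0 with hq0 | hq0
  · exact (hmax p hp).trans (max_le hq0 le_rfl)
  exfalso
  rw [max_eq_left hq0.le] at hmax
  have hconn : IsPreconnected Ω :=
    (hstar.isPathConnected (interior_subset hz₀)).isConnected.isPreconnected
  have : PreconnectedSpace Ω := Subtype.preconnectedSpace hconn
  have hφc : Continuous fun w : Ω => φ w := hφ.continuousOn.domRestrict
  have hg : Continuous fun w : Ω => f (φ w) :=
    (hf.comp hφ.continuousOn fun w hw => hφ.mapsTo w hw).domRestrict
  -- The maximum set is clopen when read on the connected `Ω`, so it would contain the projections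
  -- of boundary points.
  set S : Set Ω := {w | f (φ w) = f q} with hS
  have hclopen : IsClopen S := by
    refine ⟨isClosed_eq hg continuous_const, ?_⟩
    rw [isOpen_iff_mem_nhds]
    intro w hw
    have hwS : f (φ w) = f q := hw
    have hwMB : φ (w : ℂ) ∈ M \ B := ⟨hφ.mapsTo w w.2, fun h => by
      rw [hfB _ h] at hwS
      exact hq0.ne hwS⟩
    have hwi : φ (w : ℂ) ∈ interior M := by
      rw [hM.diff_eq] at hwMB
      exact hwMB.1
    have hev := eventually_eq_of_forall_le (mem_chart_source ℂ _) hwi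
      (hharm _ hwMB _ (chart_mem_atlas ℂ _) (mem_chart_source ℂ _))
      (fun x hx => by rw [hwS]; exact hmax x hx)
    exact (hφc.continuousAt.eventually hev).mono fun x hx => hx.trans hwS
  have huniv := hclopen.eq_univ ⟨⟨proj (Y q), hφ.proj_mem q hq⟩, by
    simp [hS, hφ.apply_proj q hq]⟩
  obtain ⟨b, hb⟩ := hB
  have hbM := hM.boundary_subset hb
  have hbS : (⟨proj (Y b), hφ.proj_mem b hbM⟩ : Ω) ∈ S := huniv ▸ mem_univ _
  simp only [hS, mem_ofPred_eq, hφ.apply_proj b hbM, hfB b hb] at hbS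
  exact hq0.ne hbS

end Parabolic

end MinimalGraph

end

theorem mainTheorem4 {R : Type*} [TopologicalSpace R] [T2Space R] [ChartedSpace ℂ R]
    [IsManifold 𝓘(ℂ) ω R] (M B : Set R) (hM : MinimalGraph.IsSurfaceWithBoundary M B)
    (hB : B.Nonempty) (Y : R → MinimalGraph.E3)
    (hY : MinimalGraph.IsConformalMinimalImmersion Y M B)
    (hproper : IsProperMap (M.domRestrict Y))
    (Ω : Set ℂ) (hΩ : IsClosed Ω) (hgraph : MinimalGraph.IsGraphOver Y M Ω)
    (p₀ : R) (hp₀ : p₀ ∈ M \ B) (hstar : StarConvex ℝ (MinimalGraph.proj (Y p₀)) Ω) :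
    MinimalGraph.IsRelativeParabolic M B := by
  have : Nonempty R := ⟨p₀⟩
  obtain ⟨φ, hφ⟩ := MinimalGraph.exists_isGraphLift hproper hgraph
  have hp₀' : p₀ ∈ interior M := by
    rw [hM.diff_eq] at hp₀
    exact hp₀.1
  have hz₀ := hφ.proj_mem_interior hM hY hp₀'
  rintro f hf ⟨C, hC⟩ hharm hfB p hp
  refine le_antisymm
    (hφ.harmonic_nonpos hproper hΩ hM hB hY hz₀ hstar hf hC hharm hfB hp) ?_
  have h := hφ.harmonic_nonpos hproper hΩ hM hB hY hz₀ hstar (f := fun q => -f q) hf.neg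
    (fun q hq => by simpa using hC q hq) (fun q hq e he hqe => (hharm q hq e he hqe).neg)
    (fun q hq => by simp [hfB q hq]) hp
  linarith
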